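/- A plane partition is a finite set $P$ of points $(i,j,k)$ with positive integer coordinates (regarded as midpoints of unit cubes) such that $(i,j,k)\in P$, $1\le i'\le i$, $1\le j'\le j$, $1\le k'\le k$ imply $(i',j',k')\in P$. It is symmetric if $(i,j,k)\in P$ implies $(j,i,k)\in P$. A plane partition contained in the box $\{1,\dots,a\}\times\{1,\dots,a\}\times\{1,\dots,c\}$ is transpose-complementary if for every $(i,j,k)$ in the box exactly one of $(i,j,k)$ and $(a+1-j,a+1-i,c+1-k)$ belongs to $P$. Write $(x)_n=x(x+1)\cdots(x+n-1)$, with $(x)_0=1$; empty products are $1$. **Theorem.** Let $\alpha\ge 1$ and $b\ge 0$ be integers. For a symmetric plane partition $P$ in the box $2\alpha\times2\alpha\times2b$ let $n(P)$ be the number of cubes of $P$ in the upper right quarter of the box, i.e. of $(i,j,k)\in P$ with $i\le j$ and $k>b$ (equivalently, the number of sets $\{(i,j,k),(j,i,k)\}\subseteq P$ with $k>b$). Then the sum $\sum_P(-1)^{n(P)}$ over all symmetric transpose-complementary plane partitions $P$ contained in the box $2\alpha\times2\alpha\times2b$ equals $$\frac{\prod_{k=1}^{\alpha/2}(b+2k)_{\alpha-1}}{\prod_{k=1}^{\alpha/2}(2k)_{\alpha-1}}\quad\text{for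 $\alpha$ even and $b$ even,}$$ $$\frac{\prod_{k=1}^{(\alpha-1)/2}(b+2k)_{\alpha}}{\prod_{k=1}^{(\alpha-1)/2}(2k)_{\alpha}}\quad\text{for $\alpha$ odd and $b$ even,}$$ $$0\quad\text{for $b$ odd.}$$ -/

import Mathlib

/-- A plane partition: a finite set of points with positive integer coordinates (midpoints of
cubes) that is closed under decreasing coordinates. -/
def IsPlanePartition (P : Finset (ℕ × ℕ × ℕ)) : Prop :=
  (∀ i j k : ℕ, (i, j, k) ∈ P → 1 ≤ i ∧ 1 ≤ j ∧ 1 ≤ k) ∧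
  ∀ i j k i' j' k' : ℕ, (i, j, k) ∈ P →
    1 ≤ i' → i' ≤ i → 1 ≤ j' → j' ≤ j → 1 ≤ k' → k' ≤ k → (i', j', k') ∈ P

/-- The cubes of the box with side lengths `a`, `b`, `c`. -/
def cubeBox (a b c : ℕ) : Finset (ℕ × ℕ × ℕ) :=
  Finset.Icc 1 a ×ˢ (Finset.Icc 1 b ×ˢ Finset.Icc 1 c)

/-- A set of cubes is symmetric if it is closed under `(i, j, k) ↦ (j, i, k)`. -/
def IsSymmetricPP (P : Finset (ℕ × ℕ × ℕ)) : Prop :=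
  ∀ i j k : ℕ, (i, j, k) ∈ P → (j, i, k) ∈ P

/-- A set of cubes in the box `a × a × c` is transpose-complementary if it contains exactly one
of the cubes `(i, j, k)` and `(a + 1 - j, a + 1 - i, c + 1 - k)`, for each cube of the box.
(The subtractions are not truncated, since `i, j ≤ a` and `k ≤ c`.) -/
def IsTransposeComplementary (a c : ℕ) (P : Finset (ℕ × ℕ × ℕ)) : Prop :=
  ∀ i j k : ℕ, (i, j, k) ∈ cubeBox a a c →
    ((i, j, k) ∈ P ↔ (a + 1 - j, a + 1 - i, c + 1 - k) ∉ P)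

open Classical in
/-- The finite set of all symmetric transpose-complementary plane partitions contained in the box
`a × a × c`. -/
noncomputable def symmTransposeCompl (a c : ℕ) : Finset (Finset (ℕ × ℕ × ℕ)) :=
  (cubeBox a a c).powerset.filter fun P =>
    IsPlanePartition P ∧ IsSymmetricPP P ∧ IsTransposeComplementary a c P

/-- The number of cubes of `P` in the upper right quarter `i ≤ j`, `k > b` of a box of height
`2 * b`. The cubes `i = j` centred on the symmetry plane are included, so that for symmetric `P`
this counts the half orbits `{(i, j, k), (j, i, k)}` of `P` in the upper half of the box. -/
def upperRightCount (b : ℕ) (P : Finset (ℕ × ℕ × ℕ)) : ℕ :=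
  (P.filter fun p => p.1 ≤ p.2.1 ∧ b < p.2.2).card

/-! By symmetry and complementarity, `P` is determined by its excess heights over the middle plane
on the triangle `i ≤ j`, `i + j ≤ 2α`. Listed by diagonals `j - i = d`, these form rows of lengths
`n + 1, n, n, n - 1, n - 1, …` with `n = α - 1`; consecutive rows interlace, and the exponent of the
sign is the sum of all entries (`sum_symmTransposeCompl_eq`). What remains is a signed count of
symplectic-type patterns with top row bounded by `b`.

Summing a determinant with entries `f j (μ i + i)` over interlacing `μ` replaces each column
function by an antidifference. One plain and one alternating summation map the functions `checker j`
to `checker (j + 1)` up to sign, so the signed count below a fixed row is a multiple of a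
determinant of checkerboard binomials (`exists_patternSum_eq_det`). The alternating sum over the top
row vanishes unless `b` and all entries of the second row are even (`boundedPatternSum_eq_sum_ite`);
this settles odd `b`.

At even arguments the checkerboard matrix splits into a block on even and a block on odd indices
(`det_checker_two_mul`). The even-indexed and odd-indexed entries of the row interlace, and summing
over one of the two families turns its block into the other, which leaves a sum of squares of
determinants (`exists_boundedPatternSum_eq`). By Cauchy–Binet this is a Gram determinant. Its
functions are centred binomial polynomials under the uniform weight on `2M + e` points, so discrete
Chebyshev polynomials triangularise it (`det_gram`). Factors independent of `b` are never tracked: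
they are fixed by the case `b = 0`, where the sum is `1`. -/

/-! ### Determinants summed over interlacing sequences. -/

/-- The integer sequences `μ` with `l 0 ≤ μ 0 ≤ l 1 ≤ μ 1 ≤ ⋯ ≤ l n`. -/
def interlacing {n : ℕ} (l : Fin (n + 1) → ℕ) : Finset (Fin n → ℕ) :=
  Fintype.piFinset fun i => Finset.Icc (l i.castSucc) (l i.succ)

theorem mem_interlacing {n : ℕ} {l : Fin (n + 1) → ℕ} {μ : Fin n → ℕ} :
    μ ∈ interlacing l ↔ ∀ i, l i.castSucc ≤ μ i ∧ μ i ≤ l i.succ := by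
  simp [interlacing]

theorem monotone_of_mem_interlacing {n : ℕ} {l : Fin (n + 1) → ℕ} {μ : Fin n → ℕ}
    (h : μ ∈ interlacing l) : Monotone μ := by
  rw [mem_interlacing] at h
  cases n with
  | zero => intro i; exact i.elim0
  | succ n =>
    rw [Fin.monotone_iff_le_succ]
    intro i
    have h1 := (h i.castSucc).2
    have h2 := (h i.succ).1
    rw [Fin.succ_castSucc] at h1
    exact h1.trans h2

theorem monotone_cons_zero {n : ℕ} {l : Fin n → ℕ} (h : Monotone l) :
    Monotone (Fin.cons 0 l : Fin (n + 1) → ℕ) := by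
  intro i j hij
  induction i using Fin.cases with
  | zero => simp
  | succ i =>
    induction j using Fin.cases with
    | zero => simp at hij
    | succ j => simpa using h (by simpa using hij)

theorem sum_Icc_add_eq_sub {f F : ℕ → ℚ} (hF : ∀ x, F (x + 1) = F x + f x) {a b : ℕ}
    (hab : a ≤ b) (i : ℕ) :
    ∑ x ∈ Finset.Icc a b, f (x + i) = F (b + (i + 1)) - F (a + i) := by
  induction b, hab using Nat.le_induction with
  | base => simp [← add_assoc, hF]
  | succ b hab ih =>
    rw [Finset.sum_Icc_succ_top (by omega), ih, show b + 1 + (i + 1) = b + (i + 1) + 1 by ring,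
      hF, show b + 1 + i = b + (i + 1) by ring]
    ring

/-- Summing an `n × n` determinant over interlacing sequences gives an `(n + 1) × (n + 1)`
determinant of antidifferences, bordered by a column of ones. -/
theorem sum_interlacing_det {n : ℕ} {f G : ℕ → ℕ → ℚ} (h0 : ∀ x, G 0 x = 1)
    (hG : ∀ j x, G (j + 1) (x + 1) = G (j + 1) x + f j x) {l : Fin (n + 1) → ℕ}
    (hl : Monotone l) :
    ∑ μ ∈ interlacing l, (Matrix.of fun i j : Fin n => f j (μ i + i)).det =
      (Matrix.of fun i j : Fin (n + 1) => G j (l i + i)).det := by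
  have key : (Matrix.of fun i j : Fin (n + 1) => G j (l i + i)).det =
      (Matrix.of fun i j : Fin (n + 1) =>
        (Fin.cases (G j (l 0)) (fun i' => G j (l i'.succ + (i' + 1)) -
          G j (l i'.castSucc + i')) i : ℚ)).det := by
    -- Subtract from each row its predecessor: as `G 0 = 1`, the first column becomes `(1, 0, …,
    -- 0)`.
    refine Matrix.det_eq_of_forall_row_eq_smul_add_pred (fun _ => 1) (fun j => by simp) ?_
    intro i j
    simp
  rw [key, Matrix.det_succ_column_zero, Fin.sum_univ_succ]
  have hz : ∑ i : Fin n, (-1 : ℚ) ^ (i.succ : ℕ) *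
      (Matrix.of fun i j : Fin (n + 1) =>
        (Fin.cases (G j (l 0)) (fun i' => G j (l i'.succ + (i' + 1)) -
          G j (l i'.castSucc + i')) i : ℚ)) i.succ 0 *
      ((Matrix.of fun i j : Fin (n + 1) =>
        (Fin.cases (G j (l 0)) (fun i' => G j (l i'.succ + (i' + 1)) -
          G j (l i'.castSucc + i')) i : ℚ)).submatrix i.succ.succAbove Fin.succ).det = 0 := by
    refine Finset.sum_eq_zero fun i _ => ?_
    simp [h0]
  rw [hz]
  simp only [Fin.val_zero, pow_zero, Matrix.of_apply, Fin.cases_zero, h0, one_mul, add_zero]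
  -- Row `i` of the remaining minor is a sum over `x ∈ [l i, l (i+1)]`, so multilinearity in the
  -- rows pulls out the sum over all interlacing `μ`.
  have := (Matrix.detRowAlternating (R := ℚ) (n := Fin n)).toMultilinearMap.map_sum_finset
    (fun i (x : ℕ) => fun j : Fin n => f j (x + i))
    (fun i => Finset.Icc (l i.castSucc) (l i.succ))
  refine Eq.trans this.symm ?_
  change Matrix.det _ = _
  congr 1
  ext i j
  simp only [Matrix.submatrix_apply, Fin.succAbove_zero, Matrix.of_apply, Fin.cases_succ,
    Finset.sum_apply, Fin.val_succ]
  exact sum_Icc_add_eq_sub (hG j) (hl (Fin.castSucc_le_succ i)) i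

/-- With left end `0` and antidifferences vanishing at `0`, the top row of the bordered matrix is
`(1, 0, …, 0)`, so the border drops out. -/
theorem sum_interlacing_cons_zero_det {n : ℕ} {f F : ℕ → ℕ → ℚ} (h0 : ∀ j, F j 0 = 0)
    (hF : ∀ j x, F j (x + 1) = F j x + f j x) {l : Fin n → ℕ} (hl : Monotone l) :
    ∑ μ ∈ interlacing (Fin.cons 0 l), (Matrix.of fun i j : Fin n => f j (μ i + i)).det =
      (Matrix.of fun i j : Fin n => F j (l i + i + 1)).det := by
  rw [sum_interlacing_det (G := fun j x => Nat.casesOn j 1 fun j => F j x) (fun _ => rfl)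
    (fun j x => hF j x) (monotone_cons_zero hl), Matrix.det_succ_row_zero, Fin.sum_univ_succ]
  rw [Finset.sum_eq_zero]
  · simp only [Fin.val_zero, pow_zero, Matrix.of_apply, Fin.cons_zero, one_mul, add_zero]
    exact one_mul _
  · intro i _
    simp [h0]

/-! ### Signed patterns as checkerboard determinants. -/

/-- The signed number of ways to extend the row `l` to a full symplectic-type pattern. -/
def patternSum : (n : ℕ) → (Fin n → ℕ) → ℚ
  | 0, _ => 1
  | n + 1, l => (-1) ^ (∑ i, l i) * ∑ κ ∈ interlacing (Fin.cons 0 l : Fin (n + 2) → ℕ),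
      (-1) ^ (∑ i, κ i) * ∑ μ ∈ interlacing κ, patternSum n μ

/-- Binomial coefficients supported on a checkerboard. -/
def checker (j l : ℕ) : ℚ := if (l + j) % 2 = 0 then (((l + j) / 2).choose j : ℚ) else 0

theorem checker_add_two (j l : ℕ) :
    checker (j + 1) (l + 2) = checker (j + 1) l + checker j (l + 1) := by
  unfold checker
  have e1 : (l + 2 + (j + 1)) % 2 = (l + (j + 1)) % 2 := by omega
  have e2 : (l + 1 + j) % 2 = (l + (j + 1)) % 2 := by omega
  rw [e1, e2]
  split_ifs with h
  · rw [show (l + 2 + (j + 1)) / 2 = (l + (j + 1)) / 2 + 1 by omega,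
      show (l + 1 + j) = l + (j + 1) by omega, Nat.choose_succ_succ]
    push_cast
    ring
  · simp

theorem checker_succ_zero (j : ℕ) : checker (j + 1) 0 = 0 := by
  unfold checker
  split_ifs
  · rw [Nat.choose_eq_zero_of_lt (by omega)]; simp
  · rfl

theorem checker_succ_one (j : ℕ) : checker (j + 1) 1 = checker j 0 := by
  cases j with
  | zero => simp [checker]
  | succ j =>
    rw [checker_succ_zero, checker]
    split_ifs
    · rw [Nat.choose_eq_zero_of_lt (by omega)]; simp
    · rfl

/-- Telescopes through the Pascal-type recurrence `checker_add_two`. -/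
theorem sum_range_checker (j x : ℕ) :
    ∑ p ∈ Finset.range (x + 1), checker j p = checker (j + 1) (x + 1) + checker (j + 1) x := by
  induction x with
  | zero => simp [checker_succ_one, checker_succ_zero]
  | succ x ih => rw [Finset.sum_range_succ, ih, checker_add_two]; ring

/-- The partial sums of `checker`, preceded by the constant function `1`. -/
def checkerSum (j x : ℕ) : ℚ :=
  match j with
  | 0 => 1
  | j + 1 => ∑ p ∈ Finset.range x, checker j p

/-- By `sum_range_checker`, `checkerSum (j + 1) y` is a sum of two neighbouring values of `checker
(j + 1)`, so the alternating sum telescopes. The constant column `j = 0` produces `checker 0`, the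
indicator of even numbers. -/
theorem sum_range_checkerSum (j x : ℕ) :
    ∑ y ∈ Finset.range (x + 1), (-1) ^ y * checkerSum j y = (-1) ^ x * checker j x := by
  induction x with
  | zero => cases j <;> simp [checkerSum, checker_succ_zero]; simp [checker]
  | succ x ih =>
    rw [Finset.sum_range_succ, ih]
    cases j with
    | zero =>
      simp only [checkerSum, checker, pow_succ]
      rcases Nat.even_or_odd x with h | h
      · have := Nat.even_iff.1 h
        rw [if_pos (by omega), if_neg (by omega)]; simp
      · have := Nat.odd_iff.1 h
        rw [if_neg (by omega), if_pos (by omega)]; simp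
    | succ j =>
      simp only [checkerSum, sum_range_checker, pow_succ]
      ring

/-- Moves the sign of a row into the column functions, evaluated at the shifted points `l i + i`;
the shifts cost a factor independent of `l`. -/
theorem pow_sum_mul_det {n : ℕ} (l : Fin n → ℕ) (g : ℕ → ℕ → ℚ) :
    (-1) ^ (∑ i, l i) * (Matrix.of fun i j : Fin n => g j (l i + i)).det =
      (∏ i : Fin n, (-1) ^ (i : ℕ)) *
        (Matrix.of fun i j : Fin n => (-1) ^ (l i + i) * g j (l i + i)).det := by
  have := Matrix.det_mul_column (fun i : Fin n => (-1 : ℚ) ^ (l i + i))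
    (Matrix.of fun i j : Fin n => g j (l i + i))
  simp only [Matrix.of_apply] at this
  rw [this, ← mul_assoc, ← Finset.prod_mul_distrib]
  congr 1
  rw [← Finset.prod_pow_eq_pow_sum]
  refine Finset.prod_congr rfl fun i _ => ?_
  rw [← pow_add, show (i : ℕ) + (l i + i) = l i + 2 * i by ring, pow_add, pow_mul]
  simp

/-- Two levels of the pattern per induction step: the sum over `μ` is plain and adds the column of
ones, the sum over `κ` is alternating and keeps the size. Together they reproduce the same family of
functions with one more column. -/
theorem exists_patternSum_eq_det (n : ℕ) : ∃ c : ℚ, ∀ l : Fin n → ℕ, Monotone l →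
    patternSum n l = c * (Matrix.of fun i j : Fin n => checker j (l i + i)).det := by
  induction n with
  | zero => exact ⟨1, fun l _ => by simp [patternSum]⟩
  | succ n ih =>
    obtain ⟨c, hc⟩ := ih
    refine ⟨c * (∏ i : Fin (n + 1), (-1) ^ (i : ℕ)) * (∏ i : Fin (n + 1), (-1) ^ (i : ℕ)),
      fun l hl => ?_⟩
    have h1 : ∀ κ ∈ interlacing (Fin.cons 0 l : Fin (n + 2) → ℕ),
        (-1) ^ (∑ i, κ i) * ∑ μ ∈ interlacing κ, patternSum n μ =
        (c * ∏ i : Fin (n + 1), (-1) ^ (i : ℕ)) * (Matrix.of fun i j : Fin (n + 1) =>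
          (-1) ^ (κ i + i) * checkerSum j (κ i + i)).det := by
      intro κ hκ
      rw [Finset.sum_congr rfl fun μ hμ => hc μ (monotone_of_mem_interlacing hμ),
        ← Finset.mul_sum, sum_interlacing_det (G := checkerSum) (fun _ => rfl)
          (fun j x => Finset.sum_range_succ _ _) (monotone_of_mem_interlacing hκ),
        mul_left_comm, pow_sum_mul_det]
      ring
    rw [patternSum, Finset.sum_congr rfl h1, ← Finset.mul_sum,
      sum_interlacing_cons_zero_det (f := fun j y => (-1) ^ y * checkerSum j y)
        (F := fun j x => ∑ y ∈ Finset.range x, (-1) ^ y * checkerSum j y)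
        (fun j => by simp) (fun j x => Finset.sum_range_succ _ _) hl]
    simp only [sum_range_checkerSum]
    rw [mul_left_comm, pow_sum_mul_det l fun j x => (-1) ^ x * checker j x]
    have h2 : ∀ x : ℕ, ∀ y : ℚ, (-1) ^ x * ((-1) ^ x * y) = y := fun x y => by
      rw [← mul_assoc, ← pow_add, ← two_mul, pow_mul]; simp
    simp only [h2]
    ring

/-! ### Summation over the top row and parity. -/

/-- Weakly increasing sequences of length `n` with values in `{0, …, b}`. -/
noncomputable def monoSeq (n b : ℕ) : Finset (Fin n → ℕ) :=
  open Classical in (Fintype.piFinset fun _ => Finset.range (b + 1)).filter Monotone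

theorem mem_monoSeq {n b : ℕ} {l : Fin n → ℕ} :
    l ∈ monoSeq n b ↔ (∀ i, l i ≤ b) ∧ Monotone l := by
  simp [monoSeq]

theorem sum_Icc_neg_one_pow {a b : ℕ} (hab : a ≤ b) :
    ∑ x ∈ Finset.Icc a b, (-1 : ℚ) ^ x = if a % 2 = b % 2 then (-1) ^ a else 0 := by
  induction b, hab using Nat.le_induction with
  | base => simp
  | succ b hab ih =>
    rw [Finset.sum_Icc_succ_top (by omega), ih]
    by_cases h : a % 2 = b % 2
    · rw [if_pos h, if_neg (by omega), neg_one_pow_eq_pow_mod_two a, h,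
        neg_one_pow_eq_pow_mod_two (b + 1), show (b + 1) % 2 = 1 - b % 2 by omega]
      rcases Nat.mod_two_eq_zero_or_one b with h | h <;> simp [h]
    · rw [if_neg h, if_pos (by omega), neg_one_pow_eq_pow_mod_two a,
        neg_one_pow_eq_pow_mod_two (b + 1), show (b + 1) % 2 = a % 2 by omega, zero_add]

/-- The sum factors over intervals, and each factor vanishes unless its endpoints have equal parity.
Starting from `0`, all endpoints must then be even. -/
theorem sum_interlacing_neg_one_pow {n : ℕ} {u : Fin (n + 1) → ℕ} (hu : Monotone u)
    (h0 : u 0 = 0) :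
    ∑ l ∈ interlacing u, (-1 : ℚ) ^ (∑ i, l i) = if ∀ i, u i % 2 = 0 then 1 else 0 := by
  have h1 : ∑ l ∈ interlacing u, (-1 : ℚ) ^ (∑ i, l i) =
      ∏ i : Fin n, ∑ x ∈ Finset.Icc (u i.castSucc) (u i.succ), (-1 : ℚ) ^ x := by
    rw [Finset.prod_univ_sum]
    exact Finset.sum_congr rfl fun l _ => (Finset.prod_pow_eq_pow_sum _ _ _).symm
  rw [h1, Finset.prod_congr rfl fun i _ => sum_Icc_neg_one_pow (hu (Fin.castSucc_le_succ i))]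
  split_ifs with h
  · refine Finset.prod_eq_one fun i _ => ?_
    rw [if_pos (by rw [h, h]), neg_one_pow_eq_pow_mod_two, h, pow_zero]
  · by_contra hne
    refine h fun i => ?_
    induction i using Fin.induction with
    | zero => simp [h0]
    | succ i ih =>
      by_contra hi
      exact hne (Finset.prod_eq_zero (Finset.mem_univ i) (if_neg (by omega)))

/-- The signed sum over all patterns with bounded top row. -/
noncomputable def boundedPatternSum (n b : ℕ) : ℚ :=
  ∑ l ∈ monoSeq (n + 1) b, (-1) ^ (∑ i, l i) * ∑ μ ∈ interlacing l, patternSum n μ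

/-- Allows the order of summation to be exchanged: for fixed `μ`, the bounded rows above it are
exactly those interlacing `(0, μ, b)`. -/
theorem mem_interlacing_cons_snoc {n b : ℕ} {l : Fin (n + 1) → ℕ} {μ : Fin n → ℕ} :
    l ∈ monoSeq (n + 1) b ∧ μ ∈ interlacing l ↔
      l ∈ interlacing (Fin.cons 0 (Fin.snoc μ b) : Fin (n + 2) → ℕ) ∧ μ ∈ monoSeq n b := by
  constructor
  · rintro ⟨hl, hμ⟩
    have hm := monotone_of_mem_interlacing hμ
    rw [mem_monoSeq] at hl
    rw [mem_interlacing] at hμ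
    refine ⟨mem_interlacing.2 fun i => ⟨?_, ?_⟩, mem_monoSeq.2 ⟨fun i => (hμ i).2.trans (hl.1 _), hm⟩⟩
    · induction i using Fin.cases with
      | zero => simp
      | succ i => rw [← Fin.succ_castSucc, Fin.cons_succ, Fin.snoc_castSucc]; exact (hμ i).2
    · rw [Fin.cons_succ]
      induction i using Fin.lastCases with
      | last => simpa using hl.1 _
      | cast i => rw [Fin.snoc_castSucc]; exact (hμ i).1
  · rintro ⟨hl, hμ⟩
    have hm := monotone_of_mem_interlacing hl
    rw [mem_monoSeq] at hμ
    rw [mem_interlacing] at hl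
    refine ⟨mem_monoSeq.2 ⟨fun i => (hm (Fin.le_last i)).trans ?_, hm⟩,
      mem_interlacing.2 fun i => ⟨?_, ?_⟩⟩
    · simpa [← Fin.succ_last] using (hl (Fin.last n)).2
    · simpa using (hl i.castSucc).2
    · have := (hl i.succ).1
      rwa [← Fin.succ_castSucc, Fin.cons_succ, Fin.snoc_castSucc] at this

theorem boundedPatternSum_eq_sum_ite (n b : ℕ) :
    boundedPatternSum n b = ∑ μ ∈ monoSeq n b,
      if (∀ i, μ i % 2 = 0) ∧ b % 2 = 0 then patternSum n μ else 0 := by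
  simp only [boundedPatternSum, Finset.mul_sum]
  rw [Finset.sum_comm' (s' := fun μ => interlacing (Fin.cons 0 (Fin.snoc μ b) : Fin (n + 2) → ℕ))
    (t' := monoSeq n b) (fun l μ => mem_interlacing_cons_snoc)]
  refine Finset.sum_congr rfl fun μ hμ => ?_
  rw [mem_monoSeq] at hμ
  rw [← Finset.sum_mul, sum_interlacing_neg_one_pow]
  · have : (∀ i, (Fin.cons 0 (Fin.snoc μ b : Fin (n + 1) → ℕ) : Fin (n + 2) → ℕ) i % 2 = 0) ↔
        (∀ i, μ i % 2 = 0) ∧ b % 2 = 0 := by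
      rw [Fin.forall_fin_succ]
      simp only [Fin.cons_zero, Fin.cons_succ]
      rw [Fin.forall_fin_succ']
      simp
    simp only [this, ite_mul, one_mul, zero_mul]
  · apply monotone_cons_zero
    intro i j hij
    induction j using Fin.lastCases with
    | last =>
      induction i using Fin.lastCases with
      | last => exact le_rfl
      | cast i => simpa using hμ.1 _
    | cast j =>
      induction i using Fin.lastCases with
      | last => exact absurd hij (not_le.2 (Fin.castSucc_lt_last j))
      | cast i => simpa using hμ.2 (by simpa using hij)
  · simp

theorem boundedPatternSum_of_odd (n : ℕ) {b : ℕ} (hb : Odd b) : boundedPatternSum n b = 0 := by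
  rw [boundedPatternSum_eq_sum_ite]
  exact Finset.sum_eq_zero fun μ _ => if_neg fun h => by
    have := Nat.odd_iff.1 hb
    omega

theorem boundedPatternSum_two_mul (n β : ℕ) :
    boundedPatternSum n (2 * β) = ∑ ν ∈ monoSeq n β, patternSum n (fun i => 2 * ν i) := by
  rw [boundedPatternSum_eq_sum_ite, ← Finset.sum_filter]
  refine Finset.sum_nbij' (fun μ i => μ i / 2) (fun ν i => 2 * ν i) ?_ ?_ ?_ ?_ ?_
  · intro μ hμ
    rw [Finset.mem_filter, mem_monoSeq] at hμ
    refine mem_monoSeq.2 ⟨fun i => ?_, fun i j hij => Nat.div_le_div_right (hμ.1.2 hij)⟩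
    have := hμ.1.1 i
    omega
  · intro ν hν
    rw [mem_monoSeq] at hν
    refine Finset.mem_filter.2 ⟨mem_monoSeq.2 ⟨fun i => ?_, fun i j hij => ?_⟩, fun i => ?_, ?_⟩
    · have := hν.1 i
      omega
    · exact Nat.mul_le_mul_left 2 (hν.2 hij)
    · simp
    · simp
  · intro μ hμ
    rw [Finset.mem_filter] at hμ
    funext i
    have := hμ.2.1 i
    dsimp only; omega
  · intro ν _
    funext i
    dsimp only; omega
  · intro μ hμ
    rw [Finset.mem_filter] at hμ
    congr 1
    funext i
    have := hμ.2.1 i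
    change μ i = 2 * (μ i / 2)
    omega

/-! ### Block splitting and reduction to a sum of squares. -/

/-- The equivalence listing even positions first, then odd positions. -/
noncomputable def evenOddEquiv {n p q : ℕ} (hn : n = p + q) (h1 : q ≤ p) (h2 : p ≤ q + 1) :
    Fin p ⊕ Fin q ≃ Fin n :=
  Equiv.ofBijective (Sum.elim (fun s => ⟨2 * s, by omega⟩) (fun s => ⟨2 * s + 1, by omega⟩)) <| by
    rw [Fintype.bijective_iff_injective_and_card]
    refine ⟨?_, by simp [hn]⟩
    rintro (s | s) (t | t) h <;> simp only [Sum.elim_inl, Sum.elim_inr, Fin.mk.injEq] at h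
    · congr 1; ext; omega
    · omega
    · omega
    · congr 1; ext; omega

/-- The entry at `(i, j)` has parity condition `2 * ν i + i + j` even, so it vanishes when `i` and
`j` differ in parity. -/
theorem det_checker_two_mul {n p q : ℕ} (hn : n = p + q) (h1 : q ≤ p) (h2 : p ≤ q + 1)
    (ν : Fin n → ℕ) :
    (Matrix.of fun i j : Fin n => checker j (2 * ν i + i)).det =
      (Matrix.of fun s r : Fin p => ((ν ⟨2 * s, by omega⟩ + s + r).choose (2 * r) : ℚ)).det *
      (Matrix.of fun s r : Fin q =>
        ((ν ⟨2 * s + 1, by omega⟩ + s + r + 1).choose (2 * r + 1) : ℚ)).det := by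
  rw [← Matrix.det_submatrix_equiv_self (evenOddEquiv hn h1 h2), ← Matrix.det_fromBlocks_zero₁₂ _ 0]
  congr 1
  ext (s | s) (r | r)
  · simp only [evenOddEquiv, Matrix.submatrix_apply, Equiv.ofBijective_apply, Sum.elim_inl,
      Matrix.of_apply, checker, Matrix.fromBlocks_apply₁₁]
    rw [if_pos (by omega)]
    congr 2; omega
  · simp only [evenOddEquiv, Matrix.submatrix_apply, Equiv.ofBijective_apply, Sum.elim_inl,
      Sum.elim_inr, Matrix.of_apply, checker, Matrix.fromBlocks_apply₁₂]
    rw [if_neg (by omega)]; rfl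
  · simp only [evenOddEquiv, Matrix.submatrix_apply, Equiv.ofBijective_apply, Sum.elim_inl,
      Sum.elim_inr, Matrix.of_apply, checker, Matrix.fromBlocks_apply₂₁]
    rw [if_neg (by omega)]; rfl
  · simp only [evenOddEquiv, Matrix.submatrix_apply, Equiv.ofBijective_apply,
      Sum.elim_inr, Matrix.of_apply, checker, Matrix.fromBlocks_apply₂₂]
    rw [if_pos (by omega)]
    congr 2; omega

theorem monotone_iff_even_odd {n : ℕ} {ν : Fin n → ℕ} :
    Monotone ν ↔ (∀ s (h : 2 * s + 1 < n), ν ⟨2 * s, by omega⟩ ≤ ν ⟨2 * s + 1, h⟩) ∧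
      (∀ s (h : 2 * s + 2 < n), ν ⟨2 * s + 1, by omega⟩ ≤ ν ⟨2 * s + 2, h⟩) := by
  constructor
  · intro h
    exact ⟨fun s _ => h (Fin.mk_le_mk.2 (by omega)), fun s _ => h (Fin.mk_le_mk.2 (by omega))⟩
  · rintro ⟨h1, h2⟩
    cases n with
    | zero => intro i; exact i.elim0
    | succ n =>
      rw [Fin.monotone_iff_le_succ]
      rintro ⟨i, hi⟩
      rcases Nat.even_or_odd' i with ⟨s, rfl | rfl⟩
      · exact h1 s (by omega)
      · exact h2 s (by omega)

theorem sum_monoSeq_even {m β : ℕ} (f : (Fin m → ℕ) → (Fin m → ℕ) → ℚ) :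
    ∑ ν ∈ monoSeq (2 * m) β, f (fun s => ν ⟨2 * s, by omega⟩) (fun s => ν ⟨2 * s + 1, by omega⟩) =
      ∑ c ∈ monoSeq m β, ∑ a ∈ interlacing (Fin.cons 0 c : Fin (m + 1) → ℕ), f a c := by
  rw [Finset.sum_sigma']
  refine Finset.sum_nbij'
    (fun ν => ⟨fun s => ν ⟨2 * s + 1, by omega⟩, fun s => ν ⟨2 * s, by omega⟩⟩)
    (fun x i => if (i : ℕ) % 2 = 0 then x.2 ⟨i / 2, by omega⟩ else x.1 ⟨i / 2, by omega⟩)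
    ?_ ?_ ?_ ?_ ?_
  · intro ν hν
    rw [mem_monoSeq] at hν
    simp only [Finset.mem_sigma, mem_monoSeq, mem_interlacing]
    refine ⟨⟨fun i => hν.1 _, fun i j hij => hν.2 (Fin.mk_le_mk.2 (by
      have : (i : ℕ) ≤ j := hij
      omega))⟩, fun i => ⟨?_, ?_⟩⟩
    · obtain ⟨i, hi⟩ := i
      cases i with
      | zero => simp
      | succ i =>
        have : (⟨i + 1, hi⟩ : Fin m).castSucc = (⟨i, by omega⟩ : Fin m).succ := rfl
        rw [this, Fin.cons_succ]
        exact hν.2 (Fin.mk_le_mk.2 (by simp only; omega))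
    · rw [Fin.cons_succ]
      exact hν.2 (Fin.mk_le_mk.2 (by omega))
  · rintro ⟨c, a⟩ hx
    simp only [Finset.mem_sigma, mem_monoSeq, mem_interlacing] at hx
    obtain ⟨⟨hb, hc⟩, ha⟩ := hx
    refine mem_monoSeq.2 ⟨fun i => ?_, monotone_iff_even_odd.2 ⟨fun s h => ?_, fun s h => ?_⟩⟩
    · dsimp only
      split_ifs
      · exact ((ha _).2.trans (by rw [Fin.cons_succ])).trans (hb _)
      · exact hb _
    · dsimp only
      rw [if_pos (by omega), if_neg (by omega)]
      have := (ha ⟨s, by omega⟩).2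
      rw [Fin.cons_succ] at this
      convert this using 2 <;> simp only [Fin.mk.injEq] <;> omega
    · dsimp only
      rw [if_neg (by omega), if_pos (by omega)]
      have := (ha ⟨s + 1, by omega⟩).1
      have e : (⟨s + 1, by omega⟩ : Fin m).castSucc = (⟨s, by omega⟩ : Fin m).succ := rfl
      rw [e, Fin.cons_succ] at this
      convert this using 2 <;> simp only [Fin.mk.injEq] <;> omega
  · intro ν _
    funext i
    dsimp only
    split_ifs <;> congr 1 <;> ext <;> simp only <;> omega
  · rintro ⟨c, a⟩ _
    refine Sigma.ext ?_ (heq_of_eq ?_)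
    · funext s
      dsimp only
      rw [if_neg (by omega)]
      congr 1; ext; simp only; omega
    · funext s
      dsimp only
      rw [if_pos (by omega)]
      congr 1; ext; simp only; omega
  · intro ν _
    rfl

theorem sum_monoSeq_odd {m β : ℕ} (f : (Fin (m + 1) → ℕ) → (Fin m → ℕ) → ℚ) :
    ∑ ν ∈ monoSeq (2 * m + 1) β,
        f (fun s => ν ⟨2 * s, by omega⟩) (fun s => ν ⟨2 * s + 1, by omega⟩) =
      ∑ a ∈ monoSeq (m + 1) β, ∑ c ∈ interlacing a, f a c := by
  rw [Finset.sum_sigma']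
  refine Finset.sum_nbij'
    (fun ν => ⟨fun s => ν ⟨2 * s, by omega⟩, fun s => ν ⟨2 * s + 1, by omega⟩⟩)
    (fun x i => if h : (i : ℕ) % 2 = 0 then x.1 ⟨i / 2, by omega⟩ else x.2 ⟨i / 2, by omega⟩)
    ?_ ?_ ?_ ?_ ?_
  · intro ν hν
    rw [mem_monoSeq] at hν
    simp only [Finset.mem_sigma, mem_monoSeq, mem_interlacing]
    refine ⟨⟨fun i => hν.1 _, fun i j hij => hν.2 (Fin.mk_le_mk.2 (by
      have : (i : ℕ) ≤ j := hij
      omega))⟩, fun i => ⟨hν.2 (Fin.mk_le_mk.2 (by simp)), hν.2 (Fin.mk_le_mk.2 (by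
        simp only [Fin.val_succ]; omega))⟩⟩
  · rintro ⟨a, c⟩ hx
    simp only [Finset.mem_sigma, mem_monoSeq, mem_interlacing] at hx
    obtain ⟨⟨hb, ha⟩, hc⟩ := hx
    refine mem_monoSeq.2 ⟨fun i => ?_, monotone_iff_even_odd.2 ⟨fun s h => ?_, fun s h => ?_⟩⟩
    · dsimp only
      split_ifs
      · exact hb _
      · exact (hc _).2.trans (hb _)
    · dsimp only
      rw [dif_pos (by omega), dif_neg (by omega)]
      have := (hc ⟨s, by omega⟩).1
      convert this using 2 <;> simp only [Fin.mk.injEq, Fin.castSucc_mk] <;> omega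
    · dsimp only
      rw [dif_neg (by omega), dif_pos (by omega)]
      have := (hc ⟨s, by omega⟩).2
      convert this using 2 <;> simp only [Fin.mk.injEq, Fin.succ_mk] <;> omega
  · intro ν _
    funext i
    dsimp only
    split_ifs <;> congr 1 <;> ext <;> simp only <;> omega
  · rintro ⟨a, c⟩ _
    refine Sigma.ext ?_ (heq_of_eq ?_)
    · funext s
      dsimp only
      rw [dif_pos (by omega)]
      congr 1; ext; simp only; omega
    · funext s
      dsimp only
      rw [dif_neg (by omega)]
      congr 1; ext; simp only; omega
  · intro ν _
    rfl

/-- The matrix of central binomial polynomials of parity `e` at the points `p s + s`. -/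
def centralMatrix (e : ℕ) {m : ℕ} (p : Fin m → ℕ) : Matrix (Fin m) (Fin m) ℚ :=
  Matrix.of fun s r => ((p s + s + r + e).choose (2 * r + e) : ℚ)

/-- Here `α` is the length of the second row, one less than the `α` of the main theorem, whose
parity is therefore `e`. The block that survives squared is the even one for `e = 0` and the odd one
for `e = 1`. -/
theorem exists_boundedPatternSum_eq {α m e : ℕ} (hα : α + 1 = 2 * m + e) (he : e ≤ 1) :
    ∃ c : ℚ, ∀ β, boundedPatternSum α (2 * β) =
      c * ∑ p ∈ monoSeq m β, (centralMatrix e p).det ^ 2 := by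
  obtain ⟨c, hc⟩ := exists_patternSum_eq_det α
  refine ⟨c, fun β => ?_⟩
  rw [boundedPatternSum_two_mul, Finset.sum_congr rfl fun ν hν => hc _ (fun i j hij =>
    Nat.mul_le_mul_left 2 ((mem_monoSeq.1 hν).2 hij)), ← Finset.mul_sum]
  congr 1
  interval_cases e
  · obtain ⟨m, rfl⟩ : ∃ k, m = k + 1 := ⟨m - 1, by omega⟩
    obtain rfl : α = 2 * m + 1 := by omega
    rw [Finset.sum_congr rfl fun ν _ =>
      det_checker_two_mul (p := m + 1) (q := m) (by omega) (by omega) (by omega) ν]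
    rw [sum_monoSeq_odd (fun a c =>
      (Matrix.of fun s r : Fin (m + 1) => ((a s + s + r).choose (2 * r) : ℚ)).det *
      (Matrix.of fun s r : Fin m => ((c s + s + r + 1).choose (2 * r + 1) : ℚ)).det)]
    refine Finset.sum_congr rfl fun a ha => ?_
    -- Summation over `c` turns the odd block into the even one: `C(x+r+1, 2r+1)` has antidifference
    -- `C(x+r+1, 2r+2)`, and the border supplies the column `C(x, 0) = 1`.
    rw [← Finset.mul_sum, sum_interlacing_det
      (f := fun r x => ((x + r + 1).choose (2 * r + 1) : ℚ))
      (G := fun r x => ((x + r).choose (2 * r) : ℚ)) (by simp) ?_ (mem_monoSeq.1 ha).2, sq]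
    · rfl
    · intro j x
      rw [show x + 1 + (j + 1) = x + (j + 1) + 1 by ring, show 2 * (j + 1) = 2 * j + 1 + 1 by ring,
        Nat.choose_succ_succ]
      push_cast
      rw [add_comm]
      rfl
  · obtain rfl : α = 2 * m := by omega
    rw [Finset.sum_congr rfl fun ν _ =>
      det_checker_two_mul (p := m) (q := m) (by omega) (by omega) (by omega) ν]
    rw [sum_monoSeq_even (fun a c =>
      (Matrix.of fun s r : Fin m => ((a s + s + r).choose (2 * r) : ℚ)).det *
      (Matrix.of fun s r : Fin m => ((c s + s + r + 1).choose (2 * r + 1) : ℚ)).det)]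
    refine Finset.sum_congr rfl fun a ha => ?_
    -- Summation over `a` turns the even block into the odd one; the evaluation point `c s + s + 1`
    -- provides the missing shift by one.
    rw [← Finset.sum_mul, sum_interlacing_cons_zero_det
      (f := fun r x => ((x + r).choose (2 * r) : ℚ))
      (F := fun r x => ((x + r).choose (2 * r + 1) : ℚ)) ?_ ?_ (mem_monoSeq.1 ha).2, sq]
    · congr 2
      ext s r
      simp only [Matrix.of_apply, centralMatrix]
      congr 2; ring
    · intro j
      rw [Nat.choose_eq_zero_of_lt (by omega)]; simp
    · intro j x
      rw [show x + 1 + j = x + j + 1 by ring, Nat.choose_succ_succ]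
      push_cast
      rw [add_comm]

/-! ### The Cauchy–Binet formula. -/

theorem add_id_mem_of_mem_monoSeq {m β : ℕ} {p : Fin m → ℕ} (hp : p ∈ monoSeq m β) :
    StrictMono (fun s => p s + (s : ℕ)) ∧ ∀ s, p s + (s : ℕ) < β + m := by
  rw [mem_monoSeq] at hp
  refine ⟨fun i j hij => ?_, fun s => ?_⟩
  · have h1 := hp.2 hij.le
    have h2 : (i : ℕ) < j := hij
    dsimp only; omega
  · have := hp.1 s
    omega

theorem exists_mem_monoSeq {m β : ℕ} {k : Fin m → ℕ} (hk : StrictMono k) (hb : ∀ s, k s < β + m) :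
    ∃ p ∈ monoSeq m β, k = fun s => p s + (s : ℕ) := by
  have hstep : ∀ d : ℕ, ∀ i j : Fin m, (j : ℕ) = i + d → k i + d ≤ k j := by
    intro d
    induction d with
    | zero => intro i j h; rw [show i = j from Fin.ext (by omega)]; simp
    | succ d ih =>
      intro i j h
      have h1 := ih i ⟨i + d, by omega⟩ rfl
      have h2 : k ⟨i + d, by omega⟩ < k j := hk (Fin.mk_lt_mk.2 (by omega))
      omega
  have hge : ∀ s : Fin m, (s : ℕ) ≤ k s := fun s => by
    have := hstep s ⟨0, by have := s.2; omega⟩ s (by simp)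
    omega
  refine ⟨fun s => k s - s, mem_monoSeq.2 ⟨fun s => ?_, fun i j hij => ?_⟩, ?_⟩
  · have hs := s.2
    have h1 := hstep (m - 1 - s) s ⟨m - 1, by omega⟩ (by simp only; omega)
    have h2 := hb ⟨m - 1, by omega⟩
    omega
  · have h2 : (i : ℕ) ≤ j := hij
    have h1 := hstep (j - i) i j (by omega)
    dsimp only; omega
  · funext s
    have := hge s
    dsimp only; omega

/-- The Cauchy–Binet formula, with the index sets encoded by weakly increasing sequences. -/
theorem sum_monoSeq_det_mul_det (m β : ℕ) (f g : ℕ → Fin m → ℚ) :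
    ∑ p ∈ monoSeq m β, (Matrix.of fun s r : Fin m => f (p s + s) r).det *
        (Matrix.of fun s r : Fin m => g (p s + s) r).det =
      (Matrix.of fun r t : Fin m => ∑ k ∈ Finset.range (β + m), f k r * g k t).det := by
  classical
  -- Expand the right-hand determinant multilinearly over all row choices `x`. Non-injective choices
  -- give equal rows; an injective choice is a strictly increasing sequence composed with a
  -- permutation.
  have h1 := (Matrix.detRowAlternating (R := ℚ) (n := Fin m)).toMultilinearMap.map_sum_finset
    (fun r (k : ℕ) => f k r • g k) (fun _ => Finset.range (β + m))
  have h2 : (Matrix.of fun r t : Fin m => ∑ k ∈ Finset.range (β + m), f k r * g k t).det =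
      ∑ x ∈ Fintype.piFinset fun _ : Fin m => Finset.range (β + m),
        (∏ r, f (x r) r) * (Matrix.of fun r t => g (x r) t).det := by
    refine Eq.trans ?_ (h1.trans (Finset.sum_congr rfl fun x _ => ?_))
    · change _ = Matrix.det _
      congr 1
      ext r t
      simp [Finset.sum_apply]
    · exact Matrix.det_mul_column (fun r => f (x r) r) (Matrix.of fun r t => g (x r) t)
  have h3 : ∑ x ∈ Fintype.piFinset fun _ : Fin m => Finset.range (β + m),
        (∏ r, f (x r) r) * (Matrix.of fun r t => g (x r) t).det =
      ∑ x ∈ (Fintype.piFinset fun _ : Fin m => Finset.range (β + m)).filter Function.Injective,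
        (∏ r, f (x r) r) * (Matrix.of fun r t => g (x r) t).det := by
    refine (Finset.sum_filter_of_ne fun x _ hx => ?_).symm
    by_contra hinj
    simp only [Function.Injective, not_forall] at hinj
    obtain ⟨i, j, hij, hne⟩ := hinj
    refine hx ?_
    rw [Matrix.det_zero_of_row_eq hne (by ext t; simp [hij]), mul_zero]
  rw [h2, h3]
  have h4 : ∀ p : Fin m → ℕ, (Matrix.of fun s r : Fin m => f (p s + s) r).det *
      (Matrix.of fun s r : Fin m => g (p s + s) r).det = ∑ σ : Equiv.Perm (Fin m),
        (∏ r, f (p (σ r) + (σ r : ℕ)) r) *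
          (Matrix.of fun r t => g (p (σ r) + (σ r : ℕ)) t).det := by
    intro p
    rw [Matrix.det_apply', Finset.sum_mul]
    refine Finset.sum_congr rfl fun σ _ => ?_
    have := Matrix.det_permute σ (Matrix.of fun s r : Fin m => g (p s + s) r)
    rw [show (Matrix.of fun r t => g (p (σ r) + (σ r : ℕ)) t) =
      (Matrix.of fun s r : Fin m => g (p s + s) r).submatrix σ id from rfl, this]
    simp only [Matrix.of_apply]
    ring
  simp only [h4]
  rw [Finset.sum_sigma']
  refine Finset.sum_bij (fun y _ r => y.1 (y.2 r) + (y.2 r : ℕ)) ?_ ?_ ?_ ?_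
  · rintro ⟨p, σ⟩ hy
    obtain ⟨hs, hb⟩ := add_id_mem_of_mem_monoSeq (Finset.mem_sigma.1 hy).1
    simp only [Finset.mem_filter, Fintype.mem_piFinset, Finset.mem_range]
    exact ⟨fun r => hb _, fun i j hij => σ.injective (hs.injective hij)⟩
  · rintro ⟨p, σ⟩ hy ⟨q, τ⟩ hy' heq
    obtain ⟨hs, -⟩ := add_id_mem_of_mem_monoSeq (Finset.mem_sigma.1 hy).1
    obtain ⟨hs', -⟩ := add_id_mem_of_mem_monoSeq (Finset.mem_sigma.1 hy').1
    have hr : (fun s => p s + (s : ℕ)) = fun s => q s + (s : ℕ) := by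
      refine (StrictMono.range_inj hs hs').1 ?_
      rw [← σ.surjective.range_comp (fun s => p s + (s : ℕ)),
        ← τ.surjective.range_comp (fun s => q s + (s : ℕ))]
      exact congrArg Set.range heq
    have hpq : p = q := by
      funext s
      have : p s + (s : ℕ) = q s + s := congrFun hr s
      omega
    subst hpq
    have hστ : σ = τ := Equiv.ext fun r => hs.injective (congrFun heq r)
    rw [hστ]
  · intro x hx
    simp only [Finset.mem_filter, Fintype.mem_piFinset, Finset.mem_range] at hx
    have hs : StrictMono (x ∘ Tuple.sort x) :=
      (Tuple.monotone_sort x).strictMono_of_injective (hx.2.comp (Tuple.sort x).injective)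
    obtain ⟨p, hp, hk⟩ := exists_mem_monoSeq hs (fun s => hx.1 _)
    -- `x ∘ sort` is the increasing sequence `p s + s`, so `x` is recovered with the inverse of the
    -- sorting permutation.
    refine ⟨⟨p, (Tuple.sort x)⁻¹⟩, Finset.mem_sigma.2 ⟨hp, Finset.mem_univ _⟩, ?_⟩
    funext r
    have h := congrFun hk ((Tuple.sort x)⁻¹ r)
    exact h.symm.trans (congrArg x ((Tuple.sort x).apply_symm_apply r))
  · intro y _
    rfl

/-! ### Finite differences and summation by parts. -/

/-- The binomial coefficient polynomial at integers. -/
def zchoose (x : ℤ) (n : ℕ) : ℚ := (Ring.choose x n : ℤ)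

theorem zchoose_natCast (a n : ℕ) : zchoose a n = (a.choose n : ℚ) := by
  simp [zchoose, Ring.choose_natCast]

theorem zchoose_reflect (x : ℤ) (n : ℕ) : zchoose (n - 1 - x) n = (-1) ^ n * zchoose x n := by
  unfold zchoose
  have := Ring.choose_neg (x - n + 1) n
  rw [show -(x - n + 1) = (n : ℤ) - 1 - x by ring, show x - n + 1 + n - 1 = x by ring] at this
  rw [this]
  simp [Int.negOnePow, Units.smul_def]

theorem fwdDiff_zchoose (a : ℤ) (n : ℕ) :
    fwdDiff (1 : ℤ) (fun x => zchoose (x + a) (n + 1)) = fun x => zchoose (x + a) n := by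
  funext x
  simp only [fwdDiff, zchoose]
  rw [show x + 1 + a = x + a + 1 by ring, Ring.choose_succ_succ]
  push_cast
  ring

theorem fwdDiff_iter_zchoose (a : ℤ) (n : ℕ) :
    (fwdDiff (1 : ℤ))^[n] (fun x => zchoose (x + a) n) = fun _ => 1 := by
  induction n with
  | zero => funext x; simp [zchoose]
  | succ n ih => rw [Function.iterate_succ_apply, fwdDiff_zchoose, ih]

/-- A constant `n`-th difference encodes degree at most `n` with normalised leading coefficient `c`;
this replaces polynomial degree throughout. -/
theorem fwdDiff_iter_eq_zero_of_const {f : ℤ → ℚ} {n k : ℕ} {c : ℚ}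
    (hf : (fwdDiff (1 : ℤ))^[n] f = fun _ => c) (hk : n < k) :
    (fwdDiff (1 : ℤ))^[k] f = fun _ => 0 := by
  obtain ⟨d, rfl⟩ : ∃ d, k = d + 1 + n := ⟨k - n - 1, by omega⟩
  rw [Function.iterate_add_apply, hf, Function.iterate_succ_apply, fwdDiff_const]
  induction d with
  | zero => rfl
  | succ d ih => rw [Function.iterate_succ_apply, fwdDiff_const]; exact ih (by omega)

theorem fwdDiff_iter_shift_const {f : ℤ → ℚ} {n : ℕ} {c : ℚ}
    (hf : (fwdDiff (1 : ℤ))^[n] f = fun _ => c) (a : ℤ) :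
    (fwdDiff (1 : ℤ))^[n] (fun x => f (x + a)) = fun _ => c := by
  funext x
  rw [fwdDiff_iter_comp_add, hf]

theorem fwdDiff_mul' (f g : ℤ → ℚ) :
    fwdDiff (1 : ℤ) (f * g) = fwdDiff 1 f * g + (fun x => f (x + 1)) * fwdDiff 1 g := by
  funext x
  simp only [fwdDiff, Pi.mul_apply, Pi.add_apply]
  ring

theorem fwdDiff_iter_const_mul (c : ℚ) (f : ℤ → ℚ) (n : ℕ) :
    (fwdDiff (1 : ℤ))^[n] ((fun _ => c) * f) = (fun _ => c) * (fwdDiff (1 : ℤ))^[n] f :=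
  fwdDiff_iter_const_smul (1 : ℤ) c f n

/-- Leading coefficients multiply. -/
theorem fwdDiff_iter_mul_const {a b : ℕ} {f g : ℤ → ℚ} {c d : ℚ}
    (hf : (fwdDiff (1 : ℤ))^[a] f = fun _ => c) (hg : (fwdDiff (1 : ℤ))^[b] g = fun _ => d) :
    (fwdDiff (1 : ℤ))^[a + b] (f * g) = fun _ => (a + b).choose a * c * d := by
  induction a generalizing f g b c d with
  | zero =>
    simp only [Function.iterate_zero, id_eq] at hf
    rw [hf, fwdDiff_iter_const_mul, zero_add, hg]
    funext x
    simp
  | succ a iha =>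
    induction b generalizing f g c d with
    | zero =>
      simp only [Function.iterate_zero, id_eq] at hg
      rw [hg, mul_comm f, fwdDiff_iter_const_mul, add_zero, hf]
      funext x
      simp [mul_comm]
    | succ b ihb =>
      rw [← add_assoc, Function.iterate_succ_apply, fwdDiff_mul', fwdDiff_iter_add,
        ihb (fwdDiff_iter_shift_const hf 1) hg, show a + 1 + b = a + (b + 1) by ring,
        iha hf hg]
      funext x
      simp only [Pi.add_apply]
      rw [show a + (b + 1) + 1 = (a + b + 1) + 1 by ring, Nat.choose_succ_succ,
        show a + (b + 1) = a + b + 1 by ring]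
      push_cast
      ring

theorem fwdDiff_iter_reflect (f : ℤ → ℚ) (A : ℤ) (n : ℕ) (x : ℤ) :
    (fwdDiff (1 : ℤ))^[n] (fun x => f (A - x)) x =
      (-1) ^ n * (fwdDiff (1 : ℤ))^[n] f (A - n - x) := by
  induction n generalizing f A with
  | zero => simp
  | succ n ih =>
    rw [Function.iterate_succ_apply]
    have : fwdDiff (1 : ℤ) (fun x => f (A - x)) =
        (fun _ => (-1 : ℚ)) * fun x => fwdDiff (1 : ℤ) f (A - 1 - x) := by
      funext x
      simp only [fwdDiff, Pi.mul_apply]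
      rw [show A - 1 - x + 1 = A - x by ring, show A - (x + 1) = A - 1 - x by ring]
      ring
    rw [this, fwdDiff_iter_const_mul, Pi.mul_apply, ih, Function.iterate_succ_apply]
    rw [show A - 1 - n - x = A - (n + 1 : ℕ) - x by push_cast; ring]
    ring

theorem fwdDiff_iter_eq_zero_of_vanish {f : ℤ → ℚ} {n : ℕ} {y : ℤ}
    (h : ∀ k : ℕ, k ≤ n → f (y + k) = 0) : (fwdDiff (1 : ℤ))^[n] f y = 0 := by
  rw [fwdDiff_iter_eq_sum_shift]
  refine Finset.sum_eq_zero fun k hk => ?_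
  have := h k (by simpa [Nat.lt_succ_iff] using hk)
  simp [this]

theorem sum_fwdDiff_mul (f g : ℤ → ℚ) (N : ℕ) :
    ∑ x ∈ Finset.range N, fwdDiff (1 : ℤ) f x * g x =
      f N * g N - f 0 * g 0 - ∑ x ∈ Finset.range N, f (x + 1) * fwdDiff (1 : ℤ) g x := by
  induction N with
  | zero => simp
  | succ N ih =>
    rw [Finset.sum_range_succ, ih, Finset.sum_range_succ]
    simp only [fwdDiff]
    push_cast
    ring

/-- Repeated summation by parts without boundary terms. -/
theorem sum_fwdDiff_iter_mul (n N : ℕ) (f g : ℤ → ℚ) (h0 : ∀ k : ℕ, k < n → f k = 0)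
    (hN : ∀ k : ℕ, k < n → f (N + k) = 0) :
    ∑ x ∈ Finset.range N, (fwdDiff (1 : ℤ))^[n] f x * g x =
      (-1) ^ n * ∑ x ∈ Finset.range N, f (x + n) * (fwdDiff (1 : ℤ))^[n] g x := by
  induction n generalizing f g with
  | zero => simp
  | succ n ih =>
    simp only [Function.iterate_succ_apply' _ n f]
    rw [sum_fwdDiff_mul, fwdDiff_iter_eq_zero_of_vanish (fun k hk => hN k (by omega)),
      fwdDiff_iter_eq_zero_of_vanish (fun k hk => by rw [zero_add]; exact h0 k (by omega))]
    have := ih (fun x => f (x + 1)) (fwdDiff (1 : ℤ) g)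
      (fun k hk => by exact_mod_cast h0 (k + 1) (by omega))
      (fun k hk => by
        have := hN (k + 1) (by omega)
        rw [← this]; push_cast; ring_nf)
    simp only [fwdDiff_iter_comp_add] at this
    rw [this, pow_succ, zero_mul, zero_mul]
    simp only [Function.iterate_succ_apply, Nat.cast_succ]
    have h2 : ∀ x : ℕ, f (↑x + ↑n + 1) = f (x + (n + 1)) := fun x => by rw [add_assoc]
    simp only [h2]
    ring

/-- Classifies the `(a + b + 1)`-subsets of `{0, …, N}` by their `(a + 1)`-st smallest element `x`.
-/
theorem sum_choose_mul_choose (N a b : ℕ) :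
    ∑ x ∈ Finset.range (N + 1), (x.choose a) * ((N - x).choose b) = (N + 1).choose (a + b + 1) := by
  induction b generalizing N with
  | zero =>
    simp only [Nat.choose_zero_right, mul_one, add_zero]
    induction N with
    | zero => cases a <;> simp [Nat.choose_eq_zero_of_lt]
    | succ N ih => rw [Finset.sum_range_succ, ih, Nat.choose_succ_succ (N + 1), add_comm]
  | succ b ihb =>
    induction N with
    | zero => simp [Nat.choose_eq_zero_of_lt (show 1 < a + (b + 1) + 1 by omega)]
    | succ N ih =>
      rw [Finset.sum_range_succ, Nat.sub_self, Nat.choose_zero_succ, mul_zero, add_zero]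
      have : ∀ x ∈ Finset.range (N + 1), x.choose a * (N + 1 - x).choose (b + 1) =
          x.choose a * (N - x).choose b + x.choose a * (N - x).choose (b + 1) := by
        intro x hx
        have := Finset.mem_range.1 hx
        rw [show N + 1 - x = N - x + 1 by omega, Nat.choose_succ_succ, mul_add]
      rw [Finset.sum_congr rfl this, Finset.sum_add_distrib, ih, ihb, Nat.choose_succ_succ (N + 1)]
      rfl

/-! ### Centred binomials, discrete Chebyshev polynomials and the Gram determinant. -/

/-- The central binomial polynomial of degree `2 * r + e`, with (anti)symmetry about
`(2 * M + e - 1) / 2`. -/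
def centralPoly (M e r : ℕ) (x : ℤ) : ℚ := zchoose (x + ((r : ℤ) - M)) (2 * r + e)

theorem centralPoly_reflect (M e r : ℕ) (x : ℤ) :
    centralPoly M e r ((2 * M + e : ℕ) - 1 - x) = (-1) ^ (2 * r + e) * centralPoly M e r x := by
  unfold centralPoly
  rw [← zchoose_reflect]
  congr 1
  push_cast
  ring

theorem centralPoly_upper (M e r k : ℕ) :
    centralPoly M e r ((M + e + k : ℕ) : ℤ) = ((k + r + e).choose (2 * r + e) : ℚ) := by
  unfold centralPoly
  rw [← zchoose_natCast]
  congr 1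
  push_cast
  ring

theorem eq_const_of_fwdDiff_eq_zero {f : ℤ → ℚ} (h : fwdDiff (1 : ℤ) f = fun _ => 0) :
    f = fun _ => f 0 := by
  have h1 : ∀ x, f (x + 1) = f x := fun x => sub_eq_zero.1 (congrFun h x)
  funext x
  induction x using Int.induction_on with
  | zero => rfl
  | succ i ih => rw [h1, ih]
  | pred i ih => rw [← ih, ← h1 (-i - 1)]; congr 1; ring

theorem eq_zero_of_eq_neg_one_pow {n : ℕ} {d : ℚ} (h : (-1) ^ (n + 1) * d = (-1) ^ n * d) :
    d = 0 := by
  rcases Nat.even_or_odd n with hn | hn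
  · rw [pow_succ, hn.neg_one_pow] at h; linarith
  · rw [pow_succ, hn.neg_one_pow] at h; linarith

/-- If `f` has degree at most `n` and the parity opposite to `n`, its degree is less than `n`. -/
theorem fwdDiff_iter_eq_zero_of_parity {f : ℤ → ℚ} {A : ℤ} {n : ℕ} {d : ℚ}
    (hd : (fwdDiff (1 : ℤ))^[n] f = fun _ => d)
    (hf : ∀ x, f (A - x) = (-1) ^ (n + 1) * f x) : d = 0 := by
  refine eq_zero_of_eq_neg_one_pow (n := n) ?_
  have h1 := fwdDiff_iter_reflect f A n 0
  have h2 : (fun x => f (A - x)) = (fun _ => (-1 : ℚ) ^ (n + 1)) * f := funext hf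
  rw [h2, fwdDiff_iter_const_mul, hd] at h1
  exact h1

/-- Subtracting `c * centralPoly M e r` lowers the degree, and the reflection parity forces it down
by two, so only centred binomials of the same parity occur. The leading coefficient `C r = c` is
recorded because it becomes a diagonal entry in `det_gram`. -/
theorem exists_centralPoly_expansion (M e : ℕ) (r : ℕ) :
    ∀ (f : ℤ → ℚ) (c : ℚ), (fwdDiff (1 : ℤ))^[2 * r + e] f = (fun _ => c) → e ≤ 1 →
      (∀ x, f ((2 * M + e : ℕ) - 1 - x) = (-1) ^ (2 * r + e) * f x) →
      ∃ C : ℕ → ℚ, C r = c ∧ ∀ x, f x = ∑ t ∈ Finset.range (r + 1), C t * centralPoly M e t x := by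
  induction r with
  | zero =>
    intro f c hc he hf
    refine ⟨fun _ => c, rfl, fun x => ?_⟩
    simp only [zero_add, mul_zero, Finset.range_one, Finset.sum_singleton] at hc ⊢
    interval_cases e
    · simp only [Function.iterate_zero, id_eq] at hc
      simp [hc, centralPoly, zchoose]
    · have h1 : (fwdDiff (1 : ℤ))^[1] (f - (fun _ => c) * centralPoly M 1 0) = fun _ => 0 := by
        have h2 := fwdDiff_iter_zchoose (((0 : ℕ) : ℤ) - M) 1
        have h3 : (fwdDiff (1 : ℤ))^[1] (centralPoly M 1 0) = fun _ => 1 := h2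
        have h4 : f - (fun _ => c) * centralPoly M 1 0 =
          f + (fun _ => -c) * centralPoly M 1 0 := by
            funext x; simp only [Pi.sub_apply, Pi.add_apply, Pi.mul_apply]; ring
        rw [h4, fwdDiff_iter_add, fwdDiff_iter_const_mul, h3, hc]
        funext x
        simp
      have h5 := eq_const_of_fwdDiff_eq_zero h1
      have h6 := fwdDiff_iter_eq_zero_of_parity (n := 0) (A := ((2 * M + 1 : ℕ) : ℤ) - 1) h5
        (fun x => by
          have e1 := hf x
          have e2 := centralPoly_reflect M 1 0 x
          simp only [Pi.sub_apply, Pi.mul_apply]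
          rw [e1, e2]
          ring)
      have h7 := congrFun h5 x
      rw [h6] at h7
      simp only [Pi.sub_apply, Pi.mul_apply] at h7
      linarith
  | succ r ih =>
    intro f c hc he hf
    set h : ℤ → ℚ := f + (fun _ => -c) * centralPoly M e (r + 1) with hh
    have hn : 2 * (r + 1) + e = 2 * r + e + 1 + 1 := by ring
    have h1 : (fwdDiff (1 : ℤ))^[2 * (r + 1) + e] h = fun _ => 0 := by
      have h2 : (fwdDiff (1 : ℤ))^[2 * (r + 1) + e] (centralPoly M e (r + 1)) = fun _ => 1 :=
        fwdDiff_iter_zchoose _ _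
      rw [hh, fwdDiff_iter_add, fwdDiff_iter_const_mul, h2, hc]
      funext x
      simp
    have hpar : ∀ x, h ((2 * M + e : ℕ) - 1 - x) = (-1) ^ (2 * r + e + 1 + 1) * h x := fun x => by
      have e1 := hf x
      have e2 := centralPoly_reflect M e (r + 1) x
      simp only [hh, Pi.add_apply, Pi.mul_apply]
      rw [e1, e2, hn]
      ring
    rw [hn, Function.iterate_succ_apply'] at h1
    have h3 := eq_const_of_fwdDiff_eq_zero h1
    -- Parity excludes degree `2 * r + e + 1`, so the remainder meets the induction hypothesis.
    have h4 := fwdDiff_iter_eq_zero_of_parity h3 hpar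
    rw [h4, Function.iterate_succ_apply'] at h3
    have h5 := eq_const_of_fwdDiff_eq_zero h3
    obtain ⟨C, -, hC⟩ := ih h _ h5 he (fun x => by rw [hpar, pow_add _ _ 1, pow_add _ _ 1]; ring)
    refine ⟨fun t => if t = r + 1 then c else C t, by simp, fun x => ?_⟩
    rw [Finset.sum_range_succ]
    dsimp only
    rw [if_pos rfl]
    have h6 : ∑ t ∈ Finset.range (r + 1), (if t = r + 1 then c else C t) * centralPoly M e t x =
        ∑ t ∈ Finset.range (r + 1), C t * centralPoly M e t x :=
      Finset.sum_congr rfl fun t ht => by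
        rw [if_neg (by have := Finset.mem_range.1 ht; omega)]
    rw [h6, ← hC x, hh]
    simp only [Pi.add_apply, Pi.mul_apply]
    ring

/-- The product whose `n`-th difference is the discrete Chebyshev polynomial of degree `n` on
`N` points (Rodrigues formula). -/
def rodriguesKernel (N n : ℕ) : ℤ → ℚ := (fun x => zchoose (x + 0) n) * fun x => zchoose (x + -N) n

theorem rodriguesKernel_reflect (N n : ℕ) (x : ℤ) :
    rodriguesKernel N n (N + n - 1 - x) = rodriguesKernel N n x := by
  simp only [rodriguesKernel, Pi.mul_apply]
  rw [show (N : ℤ) + n - 1 - x + 0 = n - 1 - (x + -N) by ring, zchoose_reflect,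
    show (N : ℤ) + n - 1 - x + -N = n - 1 - (x + 0) by ring, zchoose_reflect]
  have : ((-1 : ℚ) ^ n) * (-1) ^ n = 1 := by rw [← mul_pow]; simp
  linear_combination zchoose (x + -N) n * zchoose (x + 0) n * this

theorem chebyshev_reflect (N n : ℕ) (x : ℤ) :
    (fwdDiff (1 : ℤ))^[n] (rodriguesKernel N n) (N - 1 - x) =
      (-1) ^ n * (fwdDiff (1 : ℤ))^[n] (rodriguesKernel N n) x := by
  have h1 := fwdDiff_iter_reflect (rodriguesKernel N n) (N + n - 1) n x
  have h2 : (fun x => rodriguesKernel N n (N + n - 1 - x)) = rodriguesKernel N n :=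
    funext (rodriguesKernel_reflect N n)
  rw [h2, show (N : ℤ) + n - 1 - n - x = N - 1 - x by ring] at h1
  rw [h1, ← mul_assoc, ← mul_pow]
  simp

theorem fwdDiff_iter_chebyshev (N n : ℕ) :
    (fwdDiff (1 : ℤ))^[n] ((fwdDiff (1 : ℤ))^[n] (rodriguesKernel N n)) =
      fun _ => ((2 * n).choose n : ℚ) := by
  rw [← Function.iterate_add_apply, rodriguesKernel,
    fwdDiff_iter_mul_const (fwdDiff_iter_zchoose 0 n) (fwdDiff_iter_zchoose (-N) n)]
  simp [two_mul]

theorem rodriguesKernel_natCast_of_lt {N n k : ℕ} (h : k < n) : rodriguesKernel N n k = 0 := by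
  simp [rodriguesKernel, zchoose_natCast, Nat.choose_eq_zero_of_lt h]

theorem rodriguesKernel_add_of_lt {N n k : ℕ} (h : k < n) :
    rodriguesKernel N n ((N : ℤ) + k) = 0 := by
  simp [rodriguesKernel, zchoose_natCast, Nat.choose_eq_zero_of_lt h]

theorem sum_rodriguesKernel (N n : ℕ) :
    ∑ x ∈ Finset.range N, rodriguesKernel N n ((x : ℤ) + n) =
      (-1) ^ n * ((N + n).choose (2 * n + 1) : ℚ) := by
  cases N with
  | zero => simp [Nat.choose_eq_zero_of_lt (show n < 2 * n + 1 by omega)]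
  | succ N =>
    have h1 : ∀ x ∈ Finset.range (N + 1), rodriguesKernel (N + 1) n ((x : ℤ) + n) =
        (-1) ^ n * (((x + n).choose n * (N - x).choose n : ℕ) : ℚ) := by
      intro x hx
      have hx' := Finset.mem_range.1 hx
      simp only [rodriguesKernel, Pi.mul_apply]
      rw [show (x : ℤ) + n + -((N + 1 : ℕ) : ℤ) = n - 1 - ((N - x : ℕ) : ℤ) by
        rw [Nat.cast_sub (by omega)]; push_cast; ring, zchoose_reflect, add_zero, zchoose_natCast,
        ← Nat.cast_add, zchoose_natCast]
      push_cast
      ring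
    rw [Finset.sum_congr rfl h1, ← Finset.mul_sum, ← Nat.cast_sum]
    congr 2
    have h2 := sum_choose_mul_choose (N + n) n n
    rw [show N + n + 1 = n + (N + 1) by ring, Finset.sum_range_add] at h2
    rw [Finset.sum_eq_zero (fun x hx => by
      rw [Nat.choose_eq_zero_of_lt (Finset.mem_range.1 hx), zero_mul]), zero_add] at h2
    rw [show N + 1 + n = n + (N + 1) by ring, show 2 * n + 1 = n + n + 1 by ring, ← h2]
    refine Finset.sum_congr rfl fun x hx => ?_
    rw [add_comm n x, show N + n - (x + n) = N - x by omega]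

/-- Sum by parts `2r + e` times. The kernel vanishes at the `2r + e` points from `0` and from `2M +
e`, so there are no boundary terms; the differences kill lower degrees and leave `1` when `s = r`.
-/
theorem sum_chebyshev_mul_centralPoly {M e r s : ℕ} (hs : s ≤ r) :
    ∑ x ∈ Finset.range (2 * M + e),
      (fwdDiff (1 : ℤ))^[2 * r + e] (rodriguesKernel (2 * M + e) (2 * r + e)) x *
        centralPoly M e s x =
      if s = r then ((2 * M + e + (2 * r + e)).choose (2 * (2 * r + e) + 1) : ℚ) else 0 := by
  rw [sum_fwdDiff_iter_mul _ _ _ _ (fun k hk => rodriguesKernel_natCast_of_lt hk)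
    (fun k hk => rodriguesKernel_add_of_lt hk)]
  have h1 : (fwdDiff (1 : ℤ))^[2 * s + e] (centralPoly M e s) = fun _ => 1 :=
    fwdDiff_iter_zchoose _ _
  split_ifs with h
  · subst h
    rw [h1]
    simp only [mul_one]
    rw [sum_rodriguesKernel, ← mul_assoc, ← mul_pow]
    simp
  · rw [fwdDiff_iter_eq_zero_of_const h1 (by omega)]
    simp

/-- The product has even reflection symmetry, so the sum folds into two equal halves; for `e = 1`
the middle point `x = M` contributes `0`. -/
theorem sum_centralPoly_mul {M e : ℕ} (he : e ≤ 1) (r s : ℕ) :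
    ∑ x ∈ Finset.range (2 * M + e), centralPoly M e r x * centralPoly M e s x =
      2 * ∑ k ∈ Finset.range M,
        ((k + r + e).choose (2 * r + e) : ℚ) * ((k + s + e).choose (2 * s + e) : ℚ) := by
  have hup : ∑ k ∈ Finset.range M,
      centralPoly M e r (M + e + k : ℕ) * centralPoly M e s (M + e + k : ℕ) =
      ∑ k ∈ Finset.range M,
        ((k + r + e).choose (2 * r + e) : ℚ) * ((k + s + e).choose (2 * s + e) : ℚ) := by
    simp only [centralPoly_upper]
  have hlow : ∑ x ∈ Finset.range M, centralPoly M e r x * centralPoly M e s x =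
      ∑ k ∈ Finset.range M,
        centralPoly M e r (M + e + k : ℕ) * centralPoly M e s (M + e + k : ℕ) := by
    rw [← Finset.sum_range_reflect]
    refine Finset.sum_congr rfl fun k hk => ?_
    have hk' := Finset.mem_range.1 hk
    have hx : ((M - 1 - k : ℕ) : ℤ) = (2 * M + e : ℕ) - 1 - ((M + e + k : ℕ) : ℤ) := by
      rw [Nat.cast_sub (by omega), Nat.cast_sub (by omega)]; push_cast; ring
    rw [hx, centralPoly_reflect, centralPoly_reflect]
    have : ((-1 : ℚ) ^ (2 * r + e)) * (-1) ^ (2 * s + e) = 1 := by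
      rw [← pow_add, show 2 * r + e + (2 * s + e) = 2 * (r + s + e) by ring, pow_mul]; simp
    linear_combination centralPoly M e r (M + e + k : ℕ) * centralPoly M e s (M + e + k : ℕ) * this
  have hmid : ∑ x ∈ Finset.range e,
      centralPoly M e r (M + x : ℕ) * centralPoly M e s (M + x : ℕ) = 0 := by
    interval_cases e
    · simp
    · simp [centralPoly, zchoose_natCast, Nat.choose_eq_zero_of_lt (show r < 2 * r + 1 by omega)]
  rw [show 2 * M + e = M + e + M by ring, Finset.sum_range_add, Finset.sum_range_add, hlow, hmid,
    hup]
  ring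

/-- With `L` the lower triangular matrix of Chebyshev coefficients, orthogonality makes `L * G`
upper triangular, and both diagonals are known. -/
theorem det_gram (m M : ℕ) {e : ℕ} (he : e ≤ 1) :
    (Matrix.of fun r s : Fin m => ∑ k ∈ Finset.range M,
        ((k + r + e).choose (2 * r + e) : ℚ) * ((k + s + e).choose (2 * s + e) : ℚ)).det =
      ∏ r ∈ Finset.range m, ((2 * M + e + (2 * r + e)).choose (2 * (2 * r + e) + 1) : ℚ) /
        (2 * ((2 * (2 * r + e)).choose (2 * r + e) : ℚ)) := by
  choose C hC1 hC2 using fun r : ℕ => exists_centralPoly_expansion M e r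
    ((fwdDiff (1 : ℤ))^[2 * r + e] (rodriguesKernel (2 * M + e) (2 * r + e))) _
    (fwdDiff_iter_chebyshev _ _) he (fun x => chebyshev_reflect _ _ x)
  set G : Matrix (Fin m) (Fin m) ℚ := Matrix.of fun r s : Fin m => ∑ k ∈ Finset.range M,
        ((k + r + e).choose (2 * r + e) : ℚ) * ((k + s + e).choose (2 * s + e) : ℚ) with hG
  -- The factor `2` compensates for `G` summing over only half of the `2 * M + e` points.
  set L : Matrix (Fin m) (Fin m) ℚ := Matrix.of fun r t : Fin m =>
    if (t : ℕ) ≤ r then 2 * C r t else 0 with hL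
  have hLG : ∀ r s : Fin m, (L * G) r s = ∑ x ∈ Finset.range (2 * M + e),
      (fwdDiff (1 : ℤ))^[2 * r + e] (rodriguesKernel (2 * M + e) (2 * r + e)) x *
        centralPoly M e s x := by
    intro r s
    simp only [hC2, Finset.sum_mul]
    rw [Finset.sum_comm, Matrix.mul_apply]
    simp only [mul_assoc, ← Finset.mul_sum, sum_centralPoly_mul he, hL, hG, Matrix.of_apply]
    rw [Fin.sum_univ_eq_sum_range (fun t => (if t ≤ (r : ℕ) then 2 * C r t else 0) *
      ∑ k ∈ Finset.range M, ((k + t + e).choose (2 * t + e) : ℚ) *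
        ((k + s + e).choose (2 * s + e) : ℚ)) m,
      ← Finset.sum_subset (Finset.range_subset_range.2 (Nat.succ_le_of_lt r.2))]
    · refine Finset.sum_congr rfl fun t ht => ?_
      rw [if_pos (by have := Finset.mem_range.1 ht; omega)]
      ring
    · intro t _ ht
      rw [if_neg (by have := mt Finset.mem_range.2 ht; omega), zero_mul]
  have hdetL : L.det = ∏ r : Fin m, (2 * ((2 * (2 * r + e)).choose (2 * r + e) : ℚ)) := by
    rw [Matrix.det_of_isLowerTriangular]
    · refine Finset.prod_congr rfl fun r _ => ?_
      simp [hL, hC1]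
    · intro r t hrt
      have : (r : ℕ) < t := hrt
      simp only [hL, Matrix.of_apply]
      rw [if_neg (by omega)]
  have hdetX : (L * G).det =
      ∏ r : Fin m, ((2 * M + e + (2 * r + e)).choose (2 * (2 * r + e) + 1) : ℚ) := by
    rw [Matrix.det_of_isUpperTriangular]
    · refine Finset.prod_congr rfl fun r _ => ?_
      rw [hLG, sum_chebyshev_mul_centralPoly le_rfl, if_pos rfl]
    · intro r s hrs
      have : (s : ℕ) < r := hrs
      rw [hLG, sum_chebyshev_mul_centralPoly this.le, if_neg this.ne]
  rw [Matrix.det_mul, hdetL] at hdetX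
  rw [Finset.prod_div_distrib, Finset.prod_range, Finset.prod_range, eq_div_iff, mul_comm, hdetX]
  refine Finset.prod_ne_zero_iff.2 fun r _ => mul_ne_zero two_ne_zero ?_
  exact_mod_cast (Nat.choose_pos (by omega)).ne'

theorem sum_monoSeq_det_sq (m β : ℕ) {e : ℕ} (he : e ≤ 1) :
    ∑ p ∈ monoSeq m β, (centralMatrix e p).det ^ 2 =
      ∏ r ∈ Finset.range m,
        ((2 * (β + m) + e + (2 * r + e)).choose (2 * (2 * r + e) + 1) : ℚ) /
        (2 * ((2 * (2 * r + e)).choose (2 * r + e) : ℚ)) := by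
  rw [← det_gram m (β + m) he, ← sum_monoSeq_det_mul_det m β
    (fun k r => ((k + r + e).choose (2 * r + e) : ℚ))
    (fun k r => ((k + r + e).choose (2 * r + e) : ℚ))]
  exact Finset.sum_congr rfl fun p _ => sq _

/-! ### Normalisation at height zero and the product formula. -/

theorem interlacing_zero (n : ℕ) : interlacing (0 : Fin (n + 1) → ℕ) = {0} := by
  ext μ
  rw [mem_interlacing, Finset.mem_singleton]
  constructor
  · intro h
    funext i
    exact Nat.le_zero.1 (h i).2
  · rintro rfl i
    simp

theorem patternSum_zero (n : ℕ) : patternSum n 0 = 1 := by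
  induction n with
  | zero => rfl
  | succ n ih =>
    have : (Fin.cons 0 (0 : Fin (n + 1) → ℕ) : Fin (n + 2) → ℕ) = 0 := by
      funext i
      induction i using Fin.cases <;> simp
    rw [patternSum, this, interlacing_zero, Finset.sum_singleton, interlacing_zero,
      Finset.sum_singleton, ih]
    simp

theorem boundedPatternSum_zero (n : ℕ) : boundedPatternSum n 0 = 1 := by
  have : monoSeq (n + 1) 0 = {0} := by
    ext l
    rw [mem_monoSeq, Finset.mem_singleton]
    constructor
    · rintro ⟨h, -⟩
      funext i
      exact Nat.le_zero.1 (h i)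
    · rintro rfl
      exact ⟨fun i => le_rfl, monotone_const⟩
  rw [boundedPatternSum, this, Finset.sum_singleton, interlacing_zero, Finset.sum_singleton,
    patternSum_zero]
  simp

theorem prod_pairs_eq_ascFactorial (y m : ℕ) :
    ∏ k ∈ Finset.range m, (y + 2 * k) * (y + 2 * k + 1) = y.ascFactorial (2 * m) := by
  induction m with
  | zero => rfl
  | succ m ih =>
    rw [Finset.prod_range_succ, ih, show 2 * (m + 1) = 2 * m + 1 + 1 by ring,
      Nat.ascFactorial_succ, Nat.ascFactorial_succ]
    ring

/-- Both sides multiply integers over intervals with left ends `b+2, b+4, …, b+2m` and right ends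
`b+2m+2e, …, b+4m-2+2e`. On the left the ends are matched in order (translates of one interval), on
the right in reverse (nested intervals). -/
theorem prod_ascFactorial_rearrange (e m b : ℕ) :
    ∏ k ∈ Finset.range m, (b + 2 * (k + 1)).ascFactorial (2 * m - 1 + 2 * e) =
      ∏ r ∈ Finset.range m, (b + 2 * m - 2 * r).ascFactorial (2 * (2 * r + e) + 1) := by
  induction m generalizing b with
  | zero => rfl
  | succ m ih =>
    -- Each interval except the first gives up its top two integers. These pairs are consecutive and
    -- extend the first interval to the longest nested one.
    have h1 : ∏ k ∈ Finset.range m,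
        (b + 2 * (k + 1 + 1)).ascFactorial (2 * (m + 1) - 1 + 2 * e) =
        (∏ k ∈ Finset.range m, (b + 2 + 2 * (k + 1)).ascFactorial (2 * m - 1 + 2 * e)) *
          (b + 2 * m + 3 + 2 * e).ascFactorial (2 * m) := by
      rw [← prod_pairs_eq_ascFactorial, ← Finset.prod_mul_distrib]
      refine Finset.prod_congr rfl fun k hk => ?_
      have := Finset.mem_range.1 hk
      rw [show 2 * (m + 1) - 1 + 2 * e = 2 * m - 1 + 2 * e + 1 + 1 by omega,
        Nat.ascFactorial_succ, Nat.ascFactorial_succ,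
        show b + 2 * (k + 1 + 1) + (2 * m - 1 + 2 * e + 1) = b + 2 * m + 3 + 2 * e + 2 * k + 1 by
          omega,
        show b + 2 * (k + 1 + 1) + (2 * m - 1 + 2 * e) = b + 2 * m + 3 + 2 * e + 2 * k by omega,
        show b + 2 * (k + 1 + 1) = b + 2 + 2 * (k + 1) by ring]
      ring
    rw [Finset.prod_range_succ', h1, ih, Finset.prod_range_succ, mul_assoc]
    congr 1
    · refine Finset.prod_congr rfl fun r _ => ?_
      congr 1; omega
    · rw [show b + 2 * (m + 1) - 2 * m = b + 2 by omega,
        show 2 * (2 * m + e) + 1 = 2 * (m + 1) - 1 + 2 * e + 2 * m by omega,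
        ← Nat.ascFactorial_mul_ascFactorial (b + 2) (2 * (m + 1) - 1 + 2 * e) (2 * m), mul_comm,
        show b + 2 + (2 * (m + 1) - 1 + 2 * e) = b + 2 * m + 3 + 2 * e by omega]

theorem boundedPatternSum_eq_div {α m e : ℕ} (hα : α + 1 = 2 * m + e) (he : e ≤ 1) (β : ℕ) :
    boundedPatternSum α (2 * β) =
      (∏ k ∈ Finset.Icc 1 m, ((2 * β + 2 * k).ascFactorial (2 * m - 1 + 2 * e) : ℚ)) /
        ∏ k ∈ Finset.Icc 1 m, ((2 * k).ascFactorial (2 * m - 1 + 2 * e) : ℚ) := by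
  obtain ⟨c, hc⟩ := exists_boundedPatternSum_eq hα he
  have key : ∀ β, boundedPatternSum α (2 * β) =
      (c / ∏ r ∈ Finset.range m, (((2 * (2 * r + e) + 1).factorial : ℚ) *
        (2 * ((2 * (2 * r + e)).choose (2 * r + e) : ℚ)))) *
      ∏ k ∈ Finset.Icc 1 m, ((2 * β + 2 * k).ascFactorial (2 * m - 1 + 2 * e) : ℚ) := by
    intro β
    have hI : ∏ k ∈ Finset.Icc 1 m, ((2 * β + 2 * k).ascFactorial (2 * m - 1 + 2 * e) : ℚ) =
        ∏ r ∈ Finset.range m, ((2 * β + 2 * m - 2 * r).ascFactorial (2 * (2 * r + e) + 1) : ℚ) := by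
      have := prod_ascFactorial_rearrange e m (2 * β)
      rw [← Finset.Ico_succ_right_eq_Icc, Finset.prod_Ico_eq_prod_range]
      simp only [add_comm 1]
      exact_mod_cast this
    rw [hc, sum_monoSeq_det_sq m β he, hI, div_mul_eq_mul_div, mul_div_assoc,
      ← Finset.prod_div_distrib]
    congr 1
    refine Finset.prod_congr rfl fun r hr => ?_
    have hr' := Finset.mem_range.1 hr
    rw [Nat.ascFactorial_eq_factorial_mul_choose',
      show 2 * β + 2 * m - 2 * r + (2 * (2 * r + e) + 1) - 1 =
        2 * (β + m) + e + (2 * r + e) by omega]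
    push_cast
    rw [mul_div_mul_left]
    exact_mod_cast (Nat.factorial_pos _).ne'
  -- The unknown constant is read off from height zero, where the sum is `1`.
  have h0 := key 0
  rw [mul_zero, boundedPatternSum_zero] at h0
  simp only [zero_add] at h0
  rw [key β, eq_div_iff, mul_right_comm, ← h0, one_mul]
  intro hz
  rw [hz, mul_zero] at h0
  exact one_ne_zero h0

/-! ### Arrays of interlacing diagonals and their rows. -/

/-- Nonnegative arrays, listed by diagonals `y 0, y 1, …`, in which consecutive diagonals
interlace, and which vanish outside the triangle `2 * i + d < N`. -/
structure IsPattern (N : ℕ) (y : ℕ → ℕ → ℕ) : Prop where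
  succ_le : ∀ d i, y (d + 1) i ≤ y d i
  le_succ : ∀ d i, y d (i + 1) ≤ y (d + 1) i
  eq_zero : ∀ d i, N ≤ 2 * i + d → y d i = 0

theorem IsPattern.shift {N : ℕ} {y : ℕ → ℕ → ℕ} (h : IsPattern (N + 1) y) :
    IsPattern N fun d => y (d + 1) :=
  ⟨fun d i => h.succ_le (d + 1) i, fun d i => h.le_succ (d + 1) i,
    fun d i hi => h.eq_zero (d + 1) i (by omega)⟩

/-- The first `m` values of `f` in reverse order. -/
def revRow (m : ℕ) (f : ℕ → ℕ) : Fin m → ℕ := fun i => f (m - 1 - i)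

/-- The inverse of `revRow`, padded by zeros. -/
def unrevRow {m : ℕ} (l : Fin m → ℕ) : ℕ → ℕ :=
  fun i => if h : i < m then l ⟨m - 1 - i, by omega⟩ else 0

theorem revRow_unrevRow {m : ℕ} (l : Fin m → ℕ) : revRow m (unrevRow l) = l := by
  funext i
  have := i.2
  rw [revRow, unrevRow, dif_pos (by omega)]
  congr 1
  ext
  simp only
  omega

theorem unrevRow_revRow {m : ℕ} {f : ℕ → ℕ} (hf : ∀ i, m ≤ i → f i = 0) :
    unrevRow (revRow m f) = f := by
  funext i
  unfold unrevRow revRow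
  split_ifs with h
  · simp only
    congr 1
    omega
  · exact (hf i (by omega)).symm

theorem sum_revRow (m : ℕ) (f : ℕ → ℕ) : ∑ i, revRow m f i = ∑ i ∈ Finset.range m, f i := by
  rw [← Finset.sum_range_reflect, Finset.sum_range]
  rfl

theorem revRow_mem_interlacing_cons {m : ℕ} {f g : ℕ → ℕ} (h1 : ∀ i, g i ≤ f i)
    (h2 : ∀ i, f (i + 1) ≤ g i) :
    revRow m g ∈ interlacing (Fin.cons 0 (revRow m f) : Fin (m + 1) → ℕ) := by
  rw [mem_interlacing]
  intro i
  refine ⟨?_, by rw [Fin.cons_succ]; exact h1 _⟩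
  obtain ⟨i, hi⟩ := i
  cases i with
  | zero => simp
  | succ i =>
    have : (⟨i + 1, hi⟩ : Fin m).castSucc = (⟨i, by omega⟩ : Fin m).succ := rfl
    rw [this, Fin.cons_succ]
    simp only [revRow]
    rw [show m - 1 - i = m - 1 - (i + 1) + 1 by omega]
    exact h2 _

theorem revRow_mem_interlacing {m : ℕ} {f g : ℕ → ℕ} (h1 : ∀ i, g i ≤ f i)
    (h2 : ∀ i, f (i + 1) ≤ g i) : revRow m g ∈ interlacing (revRow (m + 1) f) := by
  rw [mem_interlacing]
  intro i
  have := i.2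
  simp only [revRow, Fin.val_castSucc, Fin.val_succ]
  rw [show m + 1 - 1 - (i : ℕ) = m - 1 - i + 1 by omega,
    show m + 1 - 1 - (i + 1 : ℕ) = m - 1 - i by omega]
  exact ⟨h2 _, h1 _⟩

theorem unrevRow_of_mem_interlacing_cons {m : ℕ} {l κ : Fin m → ℕ}
    (h : κ ∈ interlacing (Fin.cons 0 l : Fin (m + 1) → ℕ)) (i : ℕ) :
    unrevRow κ i ≤ unrevRow l i ∧ unrevRow l (i + 1) ≤ unrevRow κ i := by
  rw [mem_interlacing] at h
  unfold unrevRow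
  constructor
  · split_ifs with hi
    · simpa using (h ⟨m - 1 - i, by omega⟩).2
    · exact le_rfl
  · split_ifs with hi hi'
    · have h1 := (h ⟨m - 1 - i, by omega⟩).1
      have : (⟨m - 1 - i, by omega⟩ : Fin m).castSucc =
          (⟨m - 1 - (i + 1), by omega⟩ : Fin m).succ := by
        ext; simp only [Fin.castSucc_mk, Fin.succ_mk]; omega
      rwa [this, Fin.cons_succ] at h1
    · omega
    · exact Nat.zero_le _
    · exact le_rfl

theorem unrevRow_of_mem_interlacing {m : ℕ} {κ : Fin (m + 1) → ℕ} {μ : Fin m → ℕ}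
    (h : μ ∈ interlacing κ) (i : ℕ) :
    unrevRow μ i ≤ unrevRow κ i ∧ unrevRow κ (i + 1) ≤ unrevRow μ i := by
  rw [mem_interlacing] at h
  unfold unrevRow
  by_cases hi : i < m
  · rw [dif_pos hi, dif_pos (by omega), dif_pos (by omega)]
    have h1 := h ⟨m - 1 - i, by omega⟩
    refine ⟨h1.2.trans_eq ?_, le_of_eq_of_le ?_ h1.1⟩ <;> congr 1 <;> ext <;>
      simp only [Fin.castSucc_mk, Fin.succ_mk] <;> omega
  · rw [dif_neg hi, dif_neg (show ¬ i + 1 < m + 1 by omega)]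
    exact ⟨Nat.zero_le _, le_rfl⟩

/-- The rows below a given row of length `n` in a pattern. -/
def Tail : ℕ → Type
  | 0 => Unit
  | n + 1 => Σ _ : Fin (n + 1) → ℕ, Σ _ : Fin n → ℕ, Tail n

/-- All ways to complete a pattern with given row `l`. -/
def tailSet : (n : ℕ) → (Fin n → ℕ) → Finset (Tail n)
  | 0, _ => ({()} : Finset Unit)
  | n + 1, l => (interlacing (Fin.cons 0 l : Fin (n + 2) → ℕ)).sigma fun κ =>
      (interlacing κ).sigma fun μ => tailSet n μ

/-- The rows of an array below the row `y 0`. -/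
def toTail : (n : ℕ) → (ℕ → ℕ → ℕ) → Tail n
  | 0, _ => ()
  | n + 1, y => ⟨revRow (n + 1) (y 1), revRow n (y 2), toTail n fun d => y (d + 2)⟩

/-- The array with given rows. -/
def ofTail : (n : ℕ) → (Fin n → ℕ) → Tail n → ℕ → ℕ → ℕ
  | 0, _, _ => fun _ _ => 0
  | n + 1, l, t => fun d =>
    match d with
    | 0 => unrevRow l
    | 1 => unrevRow t.1
    | d + 2 => ofTail n t.2.1 t.2.2 d

/-- The sum of the entries of an array, row by row. -/
def rowsSum : ℕ → (ℕ → ℕ → ℕ) → ℕ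
  | 0, _ => 0
  | n + 1, y => ∑ i ∈ Finset.range (n + 1), y 0 i + ∑ i ∈ Finset.range (n + 1), y 1 i +
      rowsSum n fun d => y (d + 2)

theorem ofTail_zero {n : ℕ} (l : Fin n → ℕ) (t : Tail n) : ofTail n l t 0 = unrevRow l := by
  cases n with
  | zero => funext i; simp [ofTail, unrevRow]
  | succ n => rfl

theorem toTail_mem_tailSet {n : ℕ} {y : ℕ → ℕ → ℕ} (h : IsPattern (2 * n) y) :
    toTail n y ∈ tailSet n (revRow n (y 0)) := by
  induction n generalizing y with
  | zero => exact Finset.mem_singleton_self _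
  | succ n ih =>
    refine Finset.mem_sigma.2 ⟨revRow_mem_interlacing_cons (h.succ_le 0) (h.le_succ 0), ?_⟩
    exact Finset.mem_sigma.2 ⟨revRow_mem_interlacing (h.succ_le 1) (h.le_succ 1),
      ih (IsPattern.shift (IsPattern.shift h))⟩

theorem isPattern_ofTail {n : ℕ} {l : Fin n → ℕ} {t : Tail n} (ht : t ∈ tailSet n l) :
    IsPattern (2 * n) (ofTail n l t) := by
  induction n with
  | zero => exact ⟨fun _ _ => le_rfl, fun _ _ => le_rfl, fun _ _ _ => rfl⟩
  | succ n ih =>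
    obtain ⟨κ, μ, t⟩ := t
    obtain ⟨h1, h2⟩ := Finset.mem_sigma.1 ht
    obtain ⟨h2, h3⟩ := Finset.mem_sigma.1 h2
    have hp := ih h3
    dsimp only at h1 h2 h3
    refine ⟨fun d i => ?_, fun d i => ?_, fun d i hi => ?_⟩
    · match d with
      | 0 => exact (unrevRow_of_mem_interlacing_cons h1 i).1
      | 1 =>
        change ofTail n μ t 0 i ≤ unrevRow κ i
        rw [ofTail_zero]
        exact (unrevRow_of_mem_interlacing h2 i).1
      | d + 2 => exact hp.succ_le d i
    · match d with
      | 0 => exact (unrevRow_of_mem_interlacing_cons h1 i).2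
      | 1 =>
        change unrevRow κ (i + 1) ≤ ofTail n μ t 0 i
        rw [ofTail_zero]
        exact (unrevRow_of_mem_interlacing h2 i).2
      | d + 2 => exact hp.le_succ d i
    · match d with
      | 0 => exact dif_neg (by omega)
      | 1 => exact dif_neg (by omega)
      | d + 2 => exact hp.eq_zero d i (by omega)

theorem toTail_ofTail {n : ℕ} (l : Fin n → ℕ) (t : Tail n) : toTail n (ofTail n l t) = t := by
  induction n with
  | zero => rfl
  | succ n ih =>
    obtain ⟨κ, μ, t⟩ := t
    change (⟨revRow (n + 1) (unrevRow κ), revRow n (ofTail n μ t 0), toTail n (ofTail n μ t)⟩ :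
      Σ _ : Fin (n + 1) → ℕ, Σ _ : Fin n → ℕ, Tail n) = ⟨κ, μ, t⟩
    rw [ofTail_zero, revRow_unrevRow, revRow_unrevRow, ih]

theorem ofTail_toTail {n : ℕ} {y : ℕ → ℕ → ℕ} (h : IsPattern (2 * n) y) :
    ofTail n (revRow n (y 0)) (toTail n y) = y := by
  induction n generalizing y with
  | zero =>
    funext d i
    exact (h.eq_zero d i (by omega)).symm
  | succ n ih =>
    funext d
    match d with
    | 0 => exact unrevRow_revRow fun i hi => h.eq_zero 0 i (by omega)
    | 1 => exact unrevRow_revRow fun i hi => h.eq_zero 1 i (by omega)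
    | d + 2 => exact congrFun (ih (IsPattern.shift (IsPattern.shift h))) d

theorem sum_range_unrevRow {m : ℕ} (l : Fin m → ℕ) :
    ∑ i ∈ Finset.range m, unrevRow l i = ∑ i, l i := by
  rw [← sum_revRow, revRow_unrevRow]

theorem sum_tailSet_succ {n : ℕ} (l : Fin (n + 1) → ℕ) (g : Tail (n + 1) → ℚ) :
    ∑ t ∈ tailSet (n + 1) l, g t = ∑ κ ∈ interlacing (Fin.cons 0 l : Fin (n + 2) → ℕ),
      ∑ μ ∈ interlacing κ, ∑ t ∈ tailSet n μ, g ⟨κ, μ, t⟩ :=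
  (Finset.sum_sigma _ _ _).trans (Finset.sum_congr rfl fun _ _ => Finset.sum_sigma _ _ _)

theorem patternSum_eq_sum_tailSet (n : ℕ) (l : Fin n → ℕ) :
    patternSum n l = ∑ t ∈ tailSet n l, (-1) ^ rowsSum n (ofTail n l t) := by
  induction n with
  | zero =>
    change (1 : ℚ) = ∑ t ∈ ({()} : Finset Unit), (-1) ^ 0
    simp
  | succ n ih =>
    rw [patternSum, sum_tailSet_succ, Finset.mul_sum]
    refine Finset.sum_congr rfl fun κ _ => ?_
    rw [Finset.mul_sum, Finset.mul_sum]
    refine Finset.sum_congr rfl fun μ _ => ?_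
    rw [ih, Finset.mul_sum, Finset.mul_sum]
    refine Finset.sum_congr rfl fun t _ => ?_
    change _ = (-1 : ℚ) ^ (∑ i ∈ Finset.range (n + 1), unrevRow l i +
      ∑ i ∈ Finset.range (n + 1), unrevRow κ i + rowsSum n (ofTail n μ t))
    rw [sum_range_unrevRow, sum_range_unrevRow, pow_add, pow_add]
    ring

/-- Vanishing outside the triangle lets the row lengths be ignored and the sum run over a rectangle.
-/
theorem rowsSum_eq {n : ℕ} {y : ℕ → ℕ → ℕ} (h : IsPattern (2 * n) y) :
    rowsSum n y = ∑ i ∈ Finset.range n, ∑ d ∈ Finset.range (2 * n), y d i := by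
  induction n generalizing y with
  | zero => rfl
  | succ n ih =>
    rw [rowsSum, ih (IsPattern.shift (IsPattern.shift h))]
    have h1 : ∑ i ∈ Finset.range n, ∑ d ∈ Finset.range (2 * n), y (d + 2) i =
        ∑ i ∈ Finset.range (n + 1), ∑ d ∈ Finset.range (2 * n), y (d + 2) i := by
      rw [Finset.sum_range_succ, Finset.sum_eq_zero (s := Finset.range (2 * n)), add_zero]
      exact fun d _ => h.eq_zero _ _ (by omega)
    rw [h1, ← Finset.sum_add_distrib, ← Finset.sum_add_distrib]
    refine Finset.sum_congr rfl fun i _ => ?_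
    rw [show 2 * (n + 1) = 2 * n + 1 + 1 by ring, Finset.sum_range_succ', Finset.sum_range_succ']
    ring

/-- All patterns whose top row has `n + 1` entries, bounded by `b`. -/
noncomputable def patternSet (n b : ℕ) : Finset (Tail (n + 1)) :=
  (monoSeq (n + 1) b).sigma fun l => (interlacing l).sigma fun μ => tailSet n μ

/-- The rows of an array. -/
def toRows (n : ℕ) (x : ℕ → ℕ → ℕ) : Tail (n + 1) :=
  ⟨revRow (n + 1) (x 0), revRow n (x 1), toTail n fun d => x (d + 1)⟩

/-- The array with given rows. -/
def ofRows (n : ℕ) (t : Tail (n + 1)) : ℕ → ℕ → ℕ := fun d =>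
  match d with
  | 0 => unrevRow t.1
  | d + 1 => ofTail n t.2.1 t.2.2 d

theorem IsPattern.antitone {N : ℕ} {x : ℕ → ℕ → ℕ} (h : IsPattern N x) (d : ℕ) :
    Antitone (x d) :=
  antitone_nat_of_succ_le fun i => (h.le_succ d i).trans (h.succ_le d i)

theorem IsPattern.le_top {N : ℕ} {x : ℕ → ℕ → ℕ} (h : IsPattern N x) (d i : ℕ) :
    x d i ≤ x 0 0 :=
  (h.antitone d (Nat.zero_le i)).trans
    (antitone_nat_of_succ_le (f := fun d => x d 0) (fun d => h.succ_le d 0) (Nat.zero_le d))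

theorem toRows_mem {n b : ℕ} {x : ℕ → ℕ → ℕ} (h : IsPattern (2 * n + 1) x) (hb : x 0 0 ≤ b) :
    toRows n x ∈ patternSet n b := by
  refine Finset.mem_sigma.2 ⟨mem_monoSeq.2 ⟨fun i => (h.le_top _ _).trans hb, fun i j hij =>
    h.antitone 0 (Nat.sub_le_sub_left hij _)⟩, Finset.mem_sigma.2 ⟨?_, ?_⟩⟩
  · exact revRow_mem_interlacing (h.succ_le 0) (h.le_succ 0)
  · exact toTail_mem_tailSet h.shift

theorem isPattern_ofRows {n b : ℕ} {t : Tail (n + 1)} (ht : t ∈ patternSet n b) :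
    IsPattern (2 * n + 1) (ofRows n t) ∧ ofRows n t 0 0 ≤ b := by
  obtain ⟨l, μ, t⟩ := t
  obtain ⟨h1, h2⟩ := Finset.mem_sigma.1 ht
  obtain ⟨h2, h3⟩ := Finset.mem_sigma.1 h2
  dsimp only at h1 h2 h3
  have hp := isPattern_ofTail h3
  refine ⟨⟨fun d i => ?_, fun d i => ?_, fun d i hi => ?_⟩, ?_⟩
  · match d with
    | 0 =>
      change ofTail n μ t 0 i ≤ unrevRow l i
      rw [ofTail_zero]
      exact (unrevRow_of_mem_interlacing h2 i).1
    | d + 1 => exact hp.succ_le d i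
  · match d with
    | 0 =>
      change unrevRow l (i + 1) ≤ ofTail n μ t 0 i
      rw [ofTail_zero]
      exact (unrevRow_of_mem_interlacing h2 i).2
    | d + 1 => exact hp.le_succ d i
  · match d with
    | 0 => exact dif_neg (by omega)
    | d + 1 => exact hp.eq_zero d i (by omega)
  · change unrevRow l 0 ≤ b
    rw [unrevRow, dif_pos (Nat.succ_pos n)]
    exact (mem_monoSeq.1 h1).1 _

theorem toRows_ofRows {n : ℕ} (t : Tail (n + 1)) : toRows n (ofRows n t) = t := by
  obtain ⟨l, μ, t⟩ := t
  change (⟨revRow (n + 1) (unrevRow l), revRow n (ofTail n μ t 0), toTail n (ofTail n μ t)⟩ :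
      Σ _ : Fin (n + 1) → ℕ, Σ _ : Fin n → ℕ, Tail n) = ⟨l, μ, t⟩
  rw [ofTail_zero, revRow_unrevRow, revRow_unrevRow, toTail_ofTail]

theorem ofRows_toRows {n : ℕ} {x : ℕ → ℕ → ℕ} (h : IsPattern (2 * n + 1) x) :
    ofRows n (toRows n x) = x := by
  funext d
  match d with
  | 0 => exact unrevRow_revRow fun i hi => h.eq_zero 0 i (by omega)
  | d + 1 => exact congrFun (ofTail_toTail h.shift) d

/-- The sum of the entries of an array with `n + 1` entries in its top row. -/
def arraySum (n : ℕ) (x : ℕ → ℕ → ℕ) : ℕ :=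
  ∑ i ∈ Finset.range (n + 1), ∑ d ∈ Finset.range (2 * n + 1), x d i

theorem boundedPatternSum_eq_sum (n b : ℕ) :
    boundedPatternSum n b = ∑ t ∈ patternSet n b, (-1) ^ arraySum n (ofRows n t) := by
  refine Eq.trans ?_ ((Finset.sum_sigma _ _ _).trans
    (Finset.sum_congr rfl fun _ _ => Finset.sum_sigma _ _ _)).symm
  refine Finset.sum_congr rfl fun l _ => ?_
  rw [Finset.mul_sum]
  refine Finset.sum_congr rfl fun μ _ => ?_
  rw [patternSum_eq_sum_tailSet, Finset.mul_sum]
  refine Finset.sum_congr rfl fun t ht => ?_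
  have hp := isPattern_ofTail ht
  rw [← pow_add, rowsSum_eq hp, arraySum]
  congr 1
  have h1 : ∑ i ∈ Finset.range n, ∑ d ∈ Finset.range (2 * n), ofTail n μ t d i =
      ∑ i ∈ Finset.range (n + 1), ∑ d ∈ Finset.range (2 * n), ofTail n μ t d i := by
    rw [Finset.sum_range_succ, Finset.sum_eq_zero (s := Finset.range (2 * n)), add_zero]
    exact fun d _ => hp.eq_zero _ _ (by omega)
  rw [h1, ← sum_range_unrevRow, ← Finset.sum_add_distrib]
  refine Finset.sum_congr rfl fun i _ => ?_
  rw [Finset.sum_range_succ', add_comm]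
  rfl

/-! ### Plane partitions as arrays of excess heights. -/

/-- The height of a set of cubes above the unit square `(i, j)`. -/
def ppHeight (P : Finset (ℕ × ℕ × ℕ)) (i j : ℕ) : ℕ :=
  P.sup fun p => if p.1 = i ∧ p.2.1 = j then p.2.2 else 0

theorem IsPlanePartition.mem_iff {P : Finset (ℕ × ℕ × ℕ)} (hP : IsPlanePartition P) {i j k : ℕ}
    (hk : 1 ≤ k) : (i, j, k) ∈ P ↔ k ≤ ppHeight P i j := by
  constructor
  · intro h
    have := Finset.le_sup (f := fun p : ℕ × ℕ × ℕ => if p.1 = i ∧ p.2.1 = j then p.2.2 else 0) h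
    exact le_of_eq_of_le (if_pos ⟨rfl, rfl⟩).symm this
  · intro h
    obtain ⟨⟨i', j', k'⟩, hp, hk'⟩ := (Finset.le_sup_iff (show (⊥ : ℕ) < k from hk)).1 h
    dsimp only at hk'
    split_ifs at hk' with hij
    · obtain ⟨rfl, rfl⟩ := hij
      have h1 := hP.1 _ _ _ hp
      exact hP.2 _ _ _ _ _ _ hp h1.1 le_rfl h1.2.1 le_rfl hk hk'
    · omega

theorem mem_cubeBox {a b c i j k : ℕ} : (i, j, k) ∈ cubeBox a b c ↔
    (1 ≤ i ∧ i ≤ a) ∧ (1 ≤ j ∧ j ≤ b) ∧ 1 ≤ k ∧ k ≤ c := by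
  simp [cubeBox]

theorem mem_symmTransposeCompl {a c : ℕ} {P : Finset (ℕ × ℕ × ℕ)} :
    P ∈ symmTransposeCompl a c ↔ P ⊆ cubeBox a a c ∧ IsPlanePartition P ∧ IsSymmetricPP P ∧
      IsTransposeComplementary a c P := by
  simp [symmTransposeCompl]

theorem ppHeight_comm {a b : ℕ} {P : Finset (ℕ × ℕ × ℕ)}
    (hP : P ∈ symmTransposeCompl a (2 * b)) (i j : ℕ) : ppHeight P i j = ppHeight P j i := by
  obtain ⟨-, h1, h2, -⟩ := mem_symmTransposeCompl.1 hP
  have key : ∀ i j, ppHeight P i j ≤ ppHeight P j i := by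
    intro i j
    rcases Nat.eq_zero_or_pos (ppHeight P i j) with h | h
    · omega
    · exact (h1.mem_iff h).1 (h2 _ _ _ ((h1.mem_iff h).2 le_rfl))
  exact (key i j).antisymm (key j i)

theorem ppHeight_anti {a b : ℕ} {P : Finset (ℕ × ℕ × ℕ)}
    (hP : P ∈ symmTransposeCompl a (2 * b)) {i j i' j' : ℕ} (hi : 1 ≤ i') (hi' : i' ≤ i) (hj : 1 ≤ j') (hj' : j' ≤ j) :
    ppHeight P i j ≤ ppHeight P i' j' := by
  obtain ⟨-, h1, -, -⟩ := mem_symmTransposeCompl.1 hP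
  rcases Nat.eq_zero_or_pos (ppHeight P i j) with h | h
  · omega
  · exact (h1.mem_iff h).1
      (h1.2 _ _ _ _ _ _ ((h1.mem_iff h).2 le_rfl) hi hi' hj hj' h le_rfl)

theorem ppHeight_le {a b : ℕ} {P : Finset (ℕ × ℕ × ℕ)}
    (hP : P ∈ symmTransposeCompl a (2 * b)) (i j : ℕ) : ppHeight P i j ≤ 2 * b := by
  obtain ⟨h0, h1, -, -⟩ := mem_symmTransposeCompl.1 hP
  rcases Nat.eq_zero_or_pos (ppHeight P i j) with h | h
  · omega
  · exact (mem_cubeBox.1 (h0 ((h1.mem_iff h).2 le_rfl))).2.2.2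

theorem ppHeight_eq_zero {a b : ℕ} {P : Finset (ℕ × ℕ × ℕ)}
    (hP : P ∈ symmTransposeCompl a (2 * b)) {i j : ℕ} (h : a < i ∨ a < j) : ppHeight P i j = 0 := by
  obtain ⟨h0, h1, -, -⟩ := mem_symmTransposeCompl.1 hP
  by_contra hne
  have := mem_cubeBox.1 (h0 ((h1.mem_iff (Nat.pos_of_ne_zero hne)).2 le_rfl))
  omega

/-- In the column over `(i, j)`, level `k` is filled exactly when level `2b + 1 - k` over the mirror
square is empty. -/
theorem ppHeight_add {a b : ℕ} {P : Finset (ℕ × ℕ × ℕ)}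
    (hP : P ∈ symmTransposeCompl a (2 * b)) {i j : ℕ} (hi : 1 ≤ i) (hi' : i ≤ a) (hj : 1 ≤ j) (hj' : j ≤ a) :
    ppHeight P i j + ppHeight P (a + 1 - j) (a + 1 - i) = 2 * b := by
  obtain ⟨-, h1, -, h3⟩ := mem_symmTransposeCompl.1 hP
  have key : ∀ k, 1 ≤ k → k ≤ 2 * b → (k ≤ ppHeight P i j ↔
      ¬ 2 * b + 1 - k ≤ ppHeight P (a + 1 - j) (a + 1 - i)) := by
    intro k hk hk'
    rw [← h1.mem_iff hk, ← h1.mem_iff (by omega)]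
    exact h3 i j k (mem_cubeBox.2 ⟨⟨hi, hi'⟩, ⟨hj, hj'⟩, hk, hk'⟩)
  have e1 := ppHeight_le hP i j
  have e2 := ppHeight_le hP (a + 1 - j) (a + 1 - i)
  by_cases h : ppHeight P i j = 2 * b
  · rcases Nat.eq_zero_or_pos b with hb | hb
    · omega
    · have := key (2 * b) (by omega) le_rfl
      omega
  · have k1 := key (ppHeight P i j + 1) (by omega) (by omega)
    rcases Nat.eq_zero_or_pos (ppHeight P i j) with h0 | h0
    · omega
    · have k2 := key (ppHeight P i j) h0 (by omega)
      omega

/-- On or beyond the antidiagonal, the mirror square has coordinates that are no larger, hence at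
least the same height, and the two heights add to `2b`. -/
theorem ppHeight_le_half {a b : ℕ} {P : Finset (ℕ × ℕ × ℕ)}
    (hP : P ∈ symmTransposeCompl a (2 * b)) {i j : ℕ} (hi : 1 ≤ i) (hj : 1 ≤ j) (hij : a + 1 ≤ i + j) :
    ppHeight P i j ≤ b := by
  by_cases h : a < i ∨ a < j
  · rw [ppHeight_eq_zero hP h]; exact Nat.zero_le _
  · have h1 := ppHeight_add hP hi (by omega) hj (by omega)
    have h2 := ppHeight_anti hP (i := i) (j := j) (i' := a + 1 - j) (j' := a + 1 - i)
      (by omega) (by omega) (by omega) (by omega)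
    omega

/-- The excess heights over the middle of the box, listed by diagonals. -/
def toArray (b : ℕ) (P : Finset (ℕ × ℕ × ℕ)) : ℕ → ℕ → ℕ :=
  fun d i => ppHeight P (i + 1) (i + d + 1) - b

theorem isPattern_toArray {a b : ℕ} {P : Finset (ℕ × ℕ × ℕ)}
    (hP : P ∈ symmTransposeCompl a (2 * b)) :
    IsPattern (a - 1) (toArray b P) ∧ toArray b P 0 0 ≤ b := by
  refine ⟨⟨fun d i => ?_, fun d i => ?_, fun d i hi => ?_⟩, ?_⟩
  · exact Nat.sub_le_sub_right (ppHeight_anti hP (by omega) (by omega) (by omega) (by omega)) b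
  · exact Nat.sub_le_sub_right (ppHeight_anti hP (by omega) (by omega) (by omega) (by omega)) b
  · exact Nat.sub_eq_zero_of_le (ppHeight_le_half hP (by omega) (by omega) (by omega))
  · have := ppHeight_le hP (0 + 1) (0 + 0 + 1)
    unfold toArray
    omega

/-- The heights of the symmetric transpose-complementary plane partition with given excess
heights. -/
def arrayHeight (a b : ℕ) (x : ℕ → ℕ → ℕ) (i j : ℕ) : ℕ :=
  if i + j ≤ a then b + x (max i j - min i j) (min i j - 1)
  else b - x (max i j - min i j) (a - max i j)

/-- The symmetric transpose-complementary plane partition with given excess heights. -/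
def ofArray (a b : ℕ) (x : ℕ → ℕ → ℕ) : Finset (ℕ × ℕ × ℕ) :=
  (cubeBox a a (2 * b)).filter fun p => p.2.2 ≤ arrayHeight a b x p.1 p.2.1

theorem mem_ofArray {a b : ℕ} {x : ℕ → ℕ → ℕ} {i j k : ℕ} : (i, j, k) ∈ ofArray a b x ↔
    ((1 ≤ i ∧ i ≤ a) ∧ (1 ≤ j ∧ j ≤ a) ∧ 1 ≤ k ∧ k ≤ 2 * b) ∧ k ≤ arrayHeight a b x i j := by
  rw [ofArray, Finset.mem_filter, mem_cubeBox]

theorem arrayHeight_comm (a b : ℕ) (x : ℕ → ℕ → ℕ) (i j : ℕ) :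
    arrayHeight a b x i j = arrayHeight a b x j i := by
  unfold arrayHeight
  rw [max_comm, min_comm, add_comm]

theorem arrayHeight_succ_le {a b : ℕ} {x : ℕ → ℕ → ℕ}
    (hx : IsPattern (a - 1) x) {i j : ℕ} (hi : 1 ≤ i) (hi' : i + 1 ≤ a) :
    arrayHeight a b x (i + 1) j ≤ arrayHeight a b x i j := by
  unfold arrayHeight
  rcases lt_or_ge i j with hij | hij
  · rw [max_eq_right (by omega), min_eq_left (by omega), max_eq_right (by omega),
      min_eq_left (by omega)]
    have e1 := hx.le_succ (j - (i + 1)) (i - 1)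
    have e2 := hx.succ_le (j - (i + 1)) (a - j)
    rw [show j - (i + 1) + 1 = j - i by omega] at e1 e2
    rw [show i - 1 + 1 = i + 1 - 1 by omega] at e1
    split_ifs <;> omega
  · rw [max_eq_left (by omega), min_eq_right (by omega), max_eq_left (by omega),
      min_eq_right (by omega)]
    have e1 := hx.succ_le (i - j) (j - 1)
    have e2 := hx.le_succ (i - j) (a - (i + 1))
    rw [show a - (i + 1) + 1 = a - i by omega] at e2
    rw [show i - j + 1 = i + 1 - j by omega] at e1 e2
    split_ifs <;> omega

theorem arrayHeight_anti_left {a b : ℕ} {x : ℕ → ℕ → ℕ}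
    (hx : IsPattern (a - 1) x) {i i' j : ℕ} (hi : 1 ≤ i) (h : i ≤ i') (hi' : i' ≤ a) :
    arrayHeight a b x i' j ≤ arrayHeight a b x i j := by
  induction i', h using Nat.le_induction with
  | base => exact le_rfl
  | succ k hk ih =>
    exact (arrayHeight_succ_le hx (by omega) hi').trans (ih (by omega))

theorem arrayHeight_add {a b : ℕ} {x : ℕ → ℕ → ℕ}
    (hx : IsPattern (a - 1) x) (hb : x 0 0 ≤ b) {i j : ℕ} (hi : 1 ≤ i) (hi' : i ≤ a) (hj : 1 ≤ j)
    (hj' : j ≤ a) :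
    arrayHeight a b x i j + arrayHeight a b x (a + 1 - j) (a + 1 - i) = 2 * b := by
  unfold arrayHeight
  have hd : max (a + 1 - j) (a + 1 - i) - min (a + 1 - j) (a + 1 - i) = max i j - min i j := by
    omega
  rw [hd]
  have h1 := (hx.le_top (max i j - min i j) (min i j - 1)).trans hb
  have h2 := (hx.le_top (max i j - min i j) (a - max i j)).trans hb
  rw [show a - max (a + 1 - j) (a + 1 - i) = min i j - 1 by omega,
    show min (a + 1 - j) (a + 1 - i) - 1 = a - max i j by omega]
  split_ifs with c1 c2
  · omega
  · omega
  · omega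
  · have z1 := hx.eq_zero (max i j - min i j) (min i j - 1) (by omega)
    have z2 := hx.eq_zero (max i j - min i j) (a - max i j) (by omega)
    omega

theorem ofArray_mem {a b : ℕ} {x : ℕ → ℕ → ℕ}
    (hx : IsPattern (a - 1) x) (hb : x 0 0 ≤ b) : ofArray a b x ∈ symmTransposeCompl a (2 * b) := by
  refine mem_symmTransposeCompl.2 ⟨Finset.filter_subset _ _, ⟨?_, ?_⟩, ?_, ?_⟩
  · intro i j k h
    have := (mem_ofArray.1 h).1
    exact ⟨this.1.1, this.2.1.1, this.2.2.1⟩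
  · intro i j k i' j' k' h hi hi' hj hj' hk hk'
    obtain ⟨⟨hi2, hj2, hk2⟩, hh⟩ := mem_ofArray.1 h
    refine mem_ofArray.2 ⟨⟨⟨hi, by omega⟩, ⟨hj, by omega⟩, hk, by omega⟩, ?_⟩
    have h1 := arrayHeight_anti_left (b := b) (j := j) hx hi hi' hi2.2
    have h2 := arrayHeight_anti_left (b := b) (j := i') hx hj hj' hj2.2
    rw [arrayHeight_comm, arrayHeight_comm _ _ _ j'] at h2
    omega
  · intro i j k h
    obtain ⟨⟨hi, hj, hk⟩, hh⟩ := mem_ofArray.1 h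
    exact mem_ofArray.2 ⟨⟨hj, hi, hk⟩, by rwa [arrayHeight_comm]⟩
  · intro i j k h
    obtain ⟨hi, hj, hk⟩ := mem_cubeBox.1 h
    have := arrayHeight_add hx hb hi.1 hi.2 hj.1 hj.2
    rw [mem_ofArray, mem_ofArray]
    omega

theorem ppHeight_ofArray {a b : ℕ} {x : ℕ → ℕ → ℕ}
    (hx : IsPattern (a - 1) x) (hb : x 0 0 ≤ b) {i j : ℕ} (hi : 1 ≤ i) (hi' : i ≤ a) (hj : 1 ≤ j)
    (hj' : j ≤ a) : ppHeight (ofArray a b x) i j = arrayHeight a b x i j := by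
  have hP := ofArray_mem hx hb
  have hpp := (mem_symmTransposeCompl.1 hP).2.1
  have h1 := ppHeight_le hP i j
  have h2 := arrayHeight_add hx hb hi hi' hj hj'
  have key : ∀ k, 1 ≤ k → (k ≤ ppHeight (ofArray a b x) i j ↔
      k ≤ 2 * b ∧ k ≤ arrayHeight a b x i j) := by
    intro k hk
    rw [← hpp.mem_iff hk, mem_ofArray]
    omega
  have k1 := key (ppHeight (ofArray a b x) i j)
  have k2 := key (arrayHeight a b x i j)
  omega

theorem toArray_ofArray {a b : ℕ} {x : ℕ → ℕ → ℕ}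
    (hx : IsPattern (a - 1) x) (hb : x 0 0 ≤ b) : toArray b (ofArray a b x) = x := by
  have hP := ofArray_mem hx hb
  funext d i
  unfold toArray
  by_cases h : i + d + 1 ≤ a
  · rw [ppHeight_ofArray hx hb (by omega) (by omega) (by omega) h]
    unfold arrayHeight
    rw [max_eq_right (by omega), min_eq_left (by omega), show i + d + 1 - (i + 1) = d by omega,
      show i + 1 - 1 = i by omega]
    split_ifs with c
    · omega
    · have := hx.eq_zero d i (by omega)
      omega
  · rw [ppHeight_eq_zero hP (Or.inr (by omega)), hx.eq_zero d i (by omega), Nat.zero_sub]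

theorem arrayHeight_toArray {a b : ℕ} {P : Finset (ℕ × ℕ × ℕ)}
    (hP : P ∈ symmTransposeCompl a (2 * b)) {i j : ℕ} (hi : 1 ≤ i) (hij : i ≤ j) (hj : j ≤ a) :
    arrayHeight a b (toArray b P) i j = ppHeight P i j := by
  unfold arrayHeight toArray
  rw [max_eq_right hij, min_eq_left hij]
  have h1 := ppHeight_add hP hi (hij.trans hj) (hi.trans hij) hj
  split_ifs with h
  · have h2 := ppHeight_le_half hP (i := a + 1 - j) (j := a + 1 - i) (by omega) (by omega)
      (by omega)
    rw [show i - 1 + (j - i) + 1 = j by omega, show i - 1 + 1 = i by omega]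
    omega
  · have h2 := ppHeight_le_half hP hi (hi.trans hij) (by omega)
    rw [show a - j + (j - i) + 1 = a + 1 - i by omega, show a - j + 1 = a + 1 - j by omega]
    omega

theorem ofArray_toArray {a b : ℕ} {P : Finset (ℕ × ℕ × ℕ)}
    (hP : P ∈ symmTransposeCompl a (2 * b)) : ofArray a b (toArray b P) = P := by
  obtain ⟨h0, h1, -, -⟩ := mem_symmTransposeCompl.1 hP
  ext ⟨i, j, k⟩
  rw [mem_ofArray]
  have key : (1 ≤ i ∧ i ≤ a) ∧ (1 ≤ j ∧ j ≤ a) ∧ 1 ≤ k ∧ k ≤ 2 * b →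
      arrayHeight a b (toArray b P) i j = ppHeight P i j := by
    rintro ⟨hi, hj, -⟩
    rcases le_total i j with h | h
    · exact arrayHeight_toArray hP hi.1 h hj.2
    · rw [arrayHeight_comm, ppHeight_comm hP, arrayHeight_toArray hP hj.1 h hi.2]
  constructor
  · rintro ⟨hbox, hk⟩
    rw [key hbox] at hk
    exact (h1.mem_iff hbox.2.2.1).2 hk
  · intro h
    have hbox := mem_cubeBox.1 (h0 h)
    exact ⟨hbox, by rw [key hbox]; exact (h1.mem_iff hbox.2.2.1).1 h⟩

theorem upperRightCount_eq {n b : ℕ} {P : Finset (ℕ × ℕ × ℕ)}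
    (hP : P ∈ symmTransposeCompl (2 * (n + 1)) (2 * b)) :
    upperRightCount b P = arraySum n (toArray b P) := by
  have hx := (isPattern_toArray hP).1
  obtain ⟨h0, h1, -, -⟩ := mem_symmTransposeCompl.1 hP
  have hcard : arraySum n (toArray b P) =
      ((Finset.range (n + 1)).sigma fun i => (Finset.range (2 * n + 1)).sigma fun d =>
        Finset.range (toArray b P d i)).card := by
    simp [arraySum, Finset.card_sigma]
  rw [hcard, upperRightCount]
  refine Finset.card_nbij' (fun p => ⟨p.1 - 1, p.2.1 - p.1, p.2.2 - b - 1⟩)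
    (fun y => (y.1 + 1, y.1 + y.2.1 + 1, b + y.2.2 + 1)) ?_ ?_ ?_ ?_
  · rintro ⟨i, j, k⟩ hp
    obtain ⟨hp, hij, hk⟩ := Finset.mem_filter.1 hp
    dsimp only at hij hk
    have hbox := mem_cubeBox.1 (h0 hp)
    have hh := (h1.mem_iff hbox.2.2.1).1 hp
    have hpos : k - b - 1 < toArray b P (j - i) (i - 1) := by
      unfold toArray
      rw [show i - 1 + (j - i) + 1 = j by omega, show i - 1 + 1 = i by omega]
      omega
    -- A nonzero excess lies inside the triangle, which bounds `i` and `j - i`.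
    have hz := mt (hx.eq_zero (j - i) (i - 1)) (by omega)
    exact Finset.mem_coe.2 (Finset.mem_sigma.2 ⟨Finset.mem_range.2 (by dsimp only; omega),
      Finset.mem_sigma.2 ⟨Finset.mem_range.2 (by dsimp only; omega), Finset.mem_range.2 hpos⟩⟩)
  · rintro ⟨i, d, t⟩ hy
    have ht := Finset.mem_range.1
      (Finset.mem_sigma.1 (Finset.mem_sigma.1 (Finset.mem_coe.1 hy)).2).2
    change t < ppHeight P (i + 1) (i + d + 1) - b at ht
    refine Finset.mem_filter.2 ⟨(h1.mem_iff (by dsimp only; omega)).2 ?_, by dsimp only; omega,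
      by dsimp only; omega⟩
    dsimp only
    omega
  · rintro ⟨i, j, k⟩ hp
    obtain ⟨hp, hij, hk⟩ := Finset.mem_filter.1 hp
    dsimp only at hij hk
    have hbox := mem_cubeBox.1 (h0 hp)
    simp only [Prod.mk.injEq]
    omega
  · rintro ⟨i, d, t⟩ _
    dsimp only
    rw [show i + 1 - 1 = i by omega, show i + d + 1 - (i + 1) = d by omega,
      show b + t + 1 - b - 1 = t by omega]

/-! ### The bijection and the conclusion. -/

theorem sum_symmTransposeCompl_eq (n b : ℕ) :
    ∑ P ∈ symmTransposeCompl (2 * (n + 1)) (2 * b), (-1 : ℚ) ^ upperRightCount b P =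
      boundedPatternSum n b := by
  rw [boundedPatternSum_eq_sum]
  have hN : 2 * (n + 1) - 1 = 2 * n + 1 := by omega
  refine Finset.sum_nbij' (fun P => toRows n (toArray b P))
    (fun t => ofArray (2 * (n + 1)) b (ofRows n t)) ?_ ?_ ?_ ?_ ?_
  · intro P hP
    obtain ⟨h1, h2⟩ := isPattern_toArray hP
    exact toRows_mem (hN ▸ h1) h2
  · intro t ht
    obtain ⟨h1, h2⟩ := isPattern_ofRows ht
    exact ofArray_mem (hN.symm ▸ h1) h2
  · intro P hP
    rw [ofRows_toRows (hN ▸ (isPattern_toArray hP).1), ofArray_toArray hP]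
  · intro t ht
    obtain ⟨h1, h2⟩ := isPattern_ofRows ht
    rw [toArray_ofArray (hN.symm ▸ h1) h2, toRows_ofRows]
  · intro P hP
    rw [ofRows_toRows (hN ▸ (isPattern_toArray hP).1), upperRightCount_eq hP]

theorem theorem2 (α b : ℕ) (hα : 1 ≤ α) :
    (Even α → Even b →
      ∑ P ∈ symmTransposeCompl (2 * α) (2 * b), (-1 : ℚ) ^ upperRightCount b P =
        (∏ k ∈ Finset.Icc 1 (α / 2), ((b + 2 * k).ascFactorial (α - 1) : ℚ)) /
          ∏ k ∈ Finset.Icc 1 (α / 2), ((2 * k).ascFactorial (α - 1) : ℚ)) ∧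
    (Odd α → Even b →
      ∑ P ∈ symmTransposeCompl (2 * α) (2 * b), (-1 : ℚ) ^ upperRightCount b P =
        (∏ k ∈ Finset.Icc 1 ((α - 1) / 2), ((b + 2 * k).ascFactorial α : ℚ)) /
          ∏ k ∈ Finset.Icc 1 ((α - 1) / 2), ((2 * k).ascFactorial α : ℚ)) ∧
    (Odd b →
      ∑ P ∈ symmTransposeCompl (2 * α) (2 * b), (-1 : ℚ) ^ upperRightCount b P = 0) := by
  obtain ⟨n, rfl⟩ : ∃ n, α = n + 1 := ⟨α - 1, by omega⟩
  rw [sum_symmTransposeCompl_eq]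
  refine ⟨fun hα hb => ?_, fun hα hb => ?_, boundedPatternSum_of_odd n⟩
  · obtain ⟨m, hm⟩ := even_iff_exists_two_mul.1 hα
    obtain ⟨β, rfl⟩ := even_iff_exists_two_mul.1 hb
    rw [boundedPatternSum_eq_div (m := m) (e := 0) (by omega) (by omega),
      show (n + 1) / 2 = m by omega, show n + 1 - 1 = 2 * m - 1 + 2 * 0 by omega]
  · obtain ⟨m, hm⟩ := hα
    obtain ⟨β, rfl⟩ := even_iff_exists_two_mul.1 hb
    rw [boundedPatternSum_eq_div (m := m) (e := 1) (by omega) (by omega),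
      show (n + 1 - 1) / 2 = m by omega]
    -- For `m = 0` the truncated length `2 * m - 1 + 2` differs from `n + 1 = 1`, but the products
    -- are empty.
    rcases Nat.eq_zero_or_pos m with rfl | hpos
    · simp
    · rw [show n + 1 = 2 * m - 1 + 2 * 1 by omega]
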